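/- Let $a>0$, let $n\ge 2$ be an integer, let $d\mu(x)=(x^2+a^2)^{-n}\,dx$ on $\mathbb{R}$, and let $E(z)=(z+ia)^n$. For an entire function $f$ put $f^*(z)=\overline{f(\bar z)}$. Let $H(E)$ be the de Branges space of all entire functions $f$ such that $f/E$ and $f^*/E$ belong to the Hardy space $H^2(\mathbb{C}_+)$ of the upper half-plane, with inner product $\langle f,g\rangle=\int_{\mathbb{R}} f(x)\overline{g(x)}\,|E(x)|^{-2}\,dx$. (1) $E$ is of Hermite–Biehler class, i.e. it is entire and $|E(z)|>|E^*(z)|$ for $\operatorname{Im} z>0$, and it has no real zeros. There is a function $\varphi:\mathbb{R}\to\mathbb{R}$ with $\varphi'(x)=\dfrac{a}{x^2+a^2}$ such that $n\varphi$ is a phase function of $E$, i.e. $n\varphi$ is smooth and increasing and $E(x)=|E(x)|e^{-in\varphi(x)}$ for all $x\in\mathbb{R}$. (2) There are orthonormal polynomials $p_0,\dots,p_{n-1}$ for $\mu$, i.e. real polynomials with $\deg p_k=k$, positive leading coefficients, and $\int_{\mathbb{R}} p_jp_k\,d\mu=\delta_{jk}$ for $0\le j,k<n$. Any such polynomials form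 an orthonormal basis of $H(E)$. (3) Let $a_0,\dots,a_{n-1}$ be independent real standard normal random variables and let $P_n(x)=\sum_{k=0}^{n-1}a_kp_k(x)$. Then the set $Z_{\mathbb{R}}(P_n)$ of real zeros of $P_n$ has first intensity $$\rho_1(x)=\frac1\pi\sqrt{\frac{n^2-1}{3}}\;\frac{a}{x^2+a^2},$$ that is, $\mathbb{E}\big[\#(Z_{\mathbb{R}}(P_n)\cap D)\big]=\int_D\rho_1(x)\,dx$ for every Borel set $D\subset\mathbb{R}$. Consequently $$\mathbb{E}\big[\#Z_{\mathbb{R}}(P_n)\big]=\sqrt{\frac{n^2-1}{3}}.$$ -/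

import Mathlib

open MeasureTheory ProbabilityTheory Polynomial
open scoped ENNReal NNReal ContDiff

/-- The function `E^*(z) = conj (E (conj z))`. -/
noncomputable def sharp (E : ℂ → ℂ) (z : ℂ) : ℂ :=
  starRingEnd ℂ (E (starRingEnd ℂ z))

/-- The Hermite-Biehler class: entire functions with `|E(z)| > |E^*(z)|` in the open upper
half-plane. -/
def IsHermiteBiehler (E : ℂ → ℂ) : Prop :=
  Differentiable ℂ E ∧ ∀ z : ℂ, 0 < z.im → ‖sharp E z‖ < ‖E z‖

/-- Membership in the Hardy space `H²` of the upper half-plane. -/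
def MemHardyTwo (g : ℂ → ℂ) : Prop :=
  DifferentiableOn ℂ g {z : ℂ | 0 < z.im} ∧
    ∃ C : ℝ≥0, ∀ y : ℝ, 0 < y →
      ∫⁻ x : ℝ, ‖g ((x : ℂ) + (y : ℂ) * Complex.I)‖ₑ ^ 2 ≤ (C : ℝ≥0∞)

/-- Membership in the de Branges space `H(E)`: entire functions `f` such that `f / E` and
`f^* / E` belong to the Hardy space `H²` of the upper half-plane. -/
def MemDeBranges (E f : ℂ → ℂ) : Prop :=
  Differentiable ℂ f ∧ MemHardyTwo (fun z => f z / E z) ∧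
    MemHardyTwo (fun z => sharp f z / E z)

/-- The inner product `⟨f, g⟩ = ∫ f(x) conj(g(x)) |E(x)|⁻² dx` of the de Branges space `H(E)`. -/
noncomputable def deBrangesInner (E f g : ℂ → ℂ) : ℂ :=
  ∫ x : ℝ, f (x : ℂ) * starRingEnd ℂ (g (x : ℂ)) / ((‖E (x : ℂ)‖ ^ 2 : ℝ) : ℂ)

/-- The finite family `e` is an orthonormal basis of the (finite dimensional) space `H(E)`. -/
def IsDeBrangesOrthonormalBasis (E : ℂ → ℂ) {n : ℕ} (e : Fin n → ℂ → ℂ) : Prop :=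
  (∀ j k : Fin n, deBrangesInner E (e j) (e k) = if j = k then 1 else 0) ∧
    ∀ f : ℂ → ℂ, MemDeBranges E f ↔ ∃ c : Fin n → ℂ, ∀ z : ℂ, f z = ∑ k, c k * e k z

/-- `φ` is a phase function of `E`: a smooth increasing function with
`E(x) = |E(x)| e^{-iφ(x)}` on the real line. -/
def IsPhaseFunction (E : ℂ → ℂ) (φ : ℝ → ℝ) : Prop :=
  ContDiff ℝ ∞ φ ∧ StrictMono φ ∧
    ∀ x : ℝ, E (x : ℂ) = (‖E (x : ℂ)‖ : ℂ) * Complex.exp (-(Complex.I * (φ x : ℂ)))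

/-- `p 0, …, p (n - 1)` are the orthonormal polynomials of degrees `0, …, n - 1` with respect
to `μ`, normalized to have positive leading coefficients. -/
def IsOrthonormalPolynomials (μ : Measure ℝ) {n : ℕ} (p : Fin n → ℝ[X]) : Prop :=
  (∀ k : Fin n, (p k).natDegree = (k : ℕ) ∧ 0 < (p k).leadingCoeff) ∧
    ∀ j k : Fin n, ∫ x : ℝ, (p j).eval x * (p k).eval x ∂μ = if j = k then 1 else 0

/-- The measure `dμ = (x² + a²)^{-n} dx` on the real line. -/
noncomputable def poissonPowMeasure (a : ℝ) (n : ℕ) : Measure ℝ :=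
  volume.withDensity (fun x => ENNReal.ofReal (((x ^ 2 + a ^ 2) ^ n)⁻¹))

/-- The set of real zeros of the function `∑ c_k p_k`. -/
def realZeros {n : ℕ} (p : Fin n → ℝ[X]) (c : Fin n → ℝ) : Set ℝ :=
  {x : ℝ | ∑ k, c k * (p k).eval x = 0}

/-- The random set `Z` has first intensity `ρ` with respect to Lebesgue measure: for every Borel
set `D` the number of points of `Z` in `D` is a random variable, with expectation `∫_D ρ(x) dx`. -/
def HasFirstIntensity {Ω : Type*} [MeasurableSpace Ω] (P : Measure Ω) (Z : Ω → Set ℝ)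
    (ρ : ℝ → ℝ) : Prop :=
  Measurable ρ ∧ (∀ x, 0 ≤ ρ x) ∧
    ∀ D : Set ℝ, MeasurableSet D →
      AEMeasurable (fun w => (((Z w ∩ D).encard : ℕ∞) : ℝ≥0∞)) P ∧
        ∫⁻ w, (((Z w ∩ D).encard : ℕ∞) : ℝ≥0∞) ∂P = ∫⁻ x in D, ENNReal.ofReal (ρ x)

/-! The zero count rests on the substitution x = a tan s, which makes the normalised random
polynomial stationary in the angle s. All orthonormal families of n polynomials of degree less than
n share one reproducing kernel (`kernel_eq_of_orthonormal`), so it can be computed in the explicit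
family `cayleyBasis`. There it is a geometric sum, and dividing by the standard deviations turns the
covariance at a tan s and a tan t into the Dirichlet ratio r(δ) = sin(nδ) / (n sin δ) with δ = s - t
(`sum_mul_eval`).

The expectation is found by counting sign changes rather than by a Kac-Rice formula. Two standard
Gaussians with correlation r have opposite signs with probability arccos(r) / π
(`pi_gaussian_sign_change`). If an angular interval of length L is cut into M cells of width δ = L /
M, the expected number of cells with a sign change is M arccos(r(δ)) / π. Since 1 - r(δ) ~ δ²(n² -
1) / 6, this tends to (L / π) √((n² - 1) / 3) (`tendsto_arccos_dirichlet`). Almost surely the zeros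
are simple and avoid every grid point, so the sign changes eventually count the zeros exactly; the
count is at most n, and dominated convergence applies (`lintegral_encard_Ioc`). A π-λ argument
passes from half-open intervals to Borel sets.

The space H(E) consists of the polynomials of degree less than n (`memDeBranges_pow_iff`). The Hardy
bounds on f / E and f^* / E control f in L² on horizontal segments in both half-planes, averaging
|f|² over discs gives |f| = O(R^(n - 1/2)), and Cauchy's estimates kill the Taylor coefficients of
order n and higher. Real orthonormal polynomials come from Gram-Schmidt, and by dimension they span
this space. -/

open Filter Topology

/-! ### Hermite-Biehler property and phase function. -/

lemma norm_sub_mul_I_lt {a : ℝ} (ha : 0 < a) {z : ℂ} (hz : 0 < z.im) :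
    ‖z - Complex.I * (a : ℂ)‖ < ‖z + Complex.I * (a : ℂ)‖ := by
  rw [← sq_lt_sq₀ (norm_nonneg _) (norm_nonneg _), Complex.sq_norm, Complex.sq_norm,
    Complex.normSq_apply, Complex.normSq_apply]
  simp
  nlinarith [mul_pos ha hz]

lemma sharp_pow_add (a : ℝ) (n : ℕ) (z : ℂ) :
    sharp (fun z => (z + Complex.I * (a : ℂ)) ^ n) z = (z - Complex.I * (a : ℂ)) ^ n := by
  simp [sharp, sub_eq_add_neg]

lemma isHermiteBiehler_pow {a : ℝ} (ha : 0 < a) {n : ℕ} (hn : n ≠ 0) :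
    IsHermiteBiehler (fun z => (z + Complex.I * (a : ℂ)) ^ n) := by
  refine ⟨by fun_prop, fun z hz => ?_⟩
  rw [sharp_pow_add, norm_pow, norm_pow]
  exact pow_lt_pow_left₀ (norm_sub_mul_I_lt ha hz) (norm_nonneg _) hn

lemma norm_ofReal_add_I_mul (a x : ℝ) :
    ‖(x : ℂ) + Complex.I * (a : ℂ)‖ = √(x ^ 2 + a ^ 2) := by
  rw [mul_comm, Complex.norm_add_mul_I]

/-- The argument of x + ia is π/2 - arctan(x/a). The constant π/2 is invisible to the derivative of
the phase but is needed for the exact polar form. -/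
lemma ofReal_add_I_mul_eq_exp {a : ℝ} (ha : 0 < a) (x : ℝ) :
    (x : ℂ) + Complex.I * (a : ℂ) = (‖(x : ℂ) + Complex.I * (a : ℂ)‖ : ℂ) *
      Complex.exp (-(Complex.I * ((Real.arctan (x / a) - Real.pi / 2 : ℝ) : ℂ))) := by
  have h0 : 0 < √(x ^ 2 + a ^ 2) := by positivity
  have h1 : √(1 + (x / a) ^ 2) = √(x ^ 2 + a ^ 2) / a := by
    rw [show 1 + (x / a) ^ 2 = (x ^ 2 + a ^ 2) / a ^ 2 by field_simp; ring,
      Real.sqrt_div (by positivity), Real.sqrt_sq ha.le]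
  have h2 : -(Complex.I * ((Real.arctan (x / a) - Real.pi / 2 : ℝ) : ℂ)) =
      ((Real.pi / 2 - Real.arctan (x / a) : ℝ) : ℂ) * Complex.I := by push_cast; ring
  rw [h2, Complex.exp_mul_I, ← Complex.ofReal_cos, ← Complex.ofReal_sin, Real.cos_pi_div_two_sub,
    Real.sin_pi_div_two_sub, Real.sin_arctan, Real.cos_arctan, norm_ofReal_add_I_mul, h1]
  have h3 : ((√(x ^ 2 + a ^ 2) : ℝ) : ℂ) ≠ 0 := Complex.ofReal_ne_zero.2 h0.ne'
  have h4 : (a : ℂ) ≠ 0 := Complex.ofReal_ne_zero.2 ha.ne'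
  push_cast
  field_simp

lemma exists_phase_pow {a : ℝ} (ha : 0 < a) {n : ℕ} (hn : n ≠ 0) :
    ∃ φ : ℝ → ℝ, (∀ x : ℝ, HasDerivAt φ (a / (x ^ 2 + a ^ 2)) x) ∧
      IsPhaseFunction (fun z => (z + Complex.I * (a : ℂ)) ^ n) (fun x => (n : ℝ) * φ x) := by
  have hn' : (0 : ℝ) < n := by positivity
  refine ⟨fun x => Real.arctan (x / a) - Real.pi / 2, fun x => ?_, ?_, ?_, fun x => ?_⟩
  · have h := ((hasDerivAt_id x).div_const a).arctan.sub_const (Real.pi / 2)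
    have e : a / (x ^ 2 + a ^ 2) = 1 / (1 + (x / a) ^ 2) * (1 / a) := by
      field_simp
      ring
    rw [e]
    exact h
  · have h : ContDiff ℝ ∞ fun x : ℝ => Real.arctan (x / a) :=
      Real.contDiff_arctan.comp (contDiff_id.div_const a)
    exact contDiff_const.mul (h.sub contDiff_const)
  · intro x y hxy
    have : Real.arctan (x / a) < Real.arctan (y / a) :=
      Real.arctan_strictMono (by gcongr)
    simp only
    gcongr
  · simp only
    conv_lhs => rw [ofReal_add_I_mul_eq_exp ha x, mul_pow, ← Complex.exp_nat_mul]
    rw [norm_pow]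
    push_cast
    congr 2
    ring

/-! ### The weighted pairing on polynomials of degree less than n. -/

lemma norm_add_I_mul_sq (a x y : ℝ) :
    ‖((x : ℂ) + (y : ℂ) * Complex.I) + Complex.I * (a : ℂ)‖ ^ 2 = x ^ 2 + (y + a) ^ 2 := by
  rw [Complex.sq_norm, Complex.normSq_apply]
  simp
  ring

lemma natDegree_lt_of_mem_degreeLT {n : ℕ} (hn : n ≠ 0) {q : ℂ[X]} (hq : q ∈ degreeLT ℂ n) :
    q.natDegree < n := by
  rcases eq_or_ne q 0 with rfl | h
  · simpa using Nat.pos_of_ne_zero hn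
  · exact (natDegree_lt_iff_degree_lt h).2 (mem_degreeLT.1 hq)

/-- A polynomial of degree less than `n` is `O(|z + ia| ^ (n - 1))` in the closed upper
half-plane. -/
lemma exists_norm_eval_le {a : ℝ} (ha : 0 < a) {n : ℕ} (hn : n ≠ 0) {q : ℂ[X]} (hq : q ∈ degreeLT ℂ n) :
    ∃ K : ℝ, 0 ≤ K ∧ ∀ x y : ℝ, 0 ≤ y →
      ‖q.eval ((x : ℂ) + (y : ℂ) * Complex.I)‖ ≤
        K * ‖((x : ℂ) + (y : ℂ) * Complex.I) + Complex.I * (a : ℂ)‖ ^ (n - 1) := by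
  refine ⟨∑ k ∈ Finset.range n, ‖q.coeff k‖ * (a ^ (n - 1 - k))⁻¹, by positivity,
    fun x y hy => ?_⟩
  set z : ℂ := (x : ℂ) + (y : ℂ) * Complex.I
  set t := ‖z + Complex.I * (a : ℂ)‖ with ht
  have ht2 : t ^ 2 = x ^ 2 + (y + a) ^ 2 := norm_add_I_mul_sq a x y
  have h1 : a ≤ t := by
    rw [← sq_le_sq₀ ha.le (norm_nonneg _), ht2]
    nlinarith [sq_nonneg x, sq_nonneg y, mul_nonneg hy ha.le]
  have h2 : ‖z‖ ≤ t := by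
    rw [← sq_le_sq₀ (norm_nonneg _) (norm_nonneg _), ht2]
    have := norm_add_I_mul_sq 0 x y
    simp only [Complex.ofReal_zero, mul_zero, add_zero] at this
    rw [this]
    nlinarith [mul_nonneg hy ha.le]
  rw [eval_eq_sum_range' (natDegree_lt_of_mem_degreeLT hn hq) z, Finset.sum_mul]
  refine (norm_sum_le _ _).trans (Finset.sum_le_sum fun k hk => ?_)
  rw [norm_mul, norm_pow, mul_assoc]
  have hk' : k + (n - 1 - k) = n - 1 := by have := Finset.mem_range.1 hk; omega
  gcongr
  calc ‖z‖ ^ k ≤ t ^ k := by gcongr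
    _ = (a ^ (n - 1 - k))⁻¹ * (t ^ k * a ^ (n - 1 - k)) := by field_simp
    _ ≤ (a ^ (n - 1 - k))⁻¹ * (t ^ k * t ^ (n - 1 - k)) := by gcongr
    _ = _ := by rw [← pow_add, hk']

lemma integrable_inv_sq_add_sq {a : ℝ} (ha : 0 < a) :
    Integrable (fun x : ℝ => (x ^ 2 + a ^ 2)⁻¹) := by
  have h := (integrable_inv_one_add_sq.comp_div ha.ne').mul_const (a ^ 2)⁻¹
  refine h.congr (Eventually.of_forall fun x => ?_)
  simp only
  field_simp
  ring

/-- The weighted sesquilinear pairing of two complex polynomials. -/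
noncomputable def polyPairing (a : ℝ) (n : ℕ) (p q : ℂ[X]) : ℂ :=
  ∫ x : ℝ, p.eval (x : ℂ) * starRingEnd ℂ (q.eval (x : ℂ)) / (((x ^ 2 + a ^ 2) ^ n : ℝ) : ℂ)

/-- Each factor is O(|x + ia|^(n-1)), so the quotient is dominated by a multiple of 1 / (x² + a²).
Degree n would already fail, which is why the families have exactly n members. -/
lemma integrable_polyPairing {a : ℝ} (ha : 0 < a) {n : ℕ} (hn : n ≠ 0) {p q : ℂ[X]}
    (hp : p ∈ degreeLT ℂ n) (hq : q ∈ degreeLT ℂ n) :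
    Integrable (fun x : ℝ => p.eval (x : ℂ) * starRingEnd ℂ (q.eval (x : ℂ)) /
      (((x ^ 2 + a ^ 2) ^ n : ℝ) : ℂ)) := by
  obtain ⟨K, hK, hp⟩ := exists_norm_eval_le ha hn hp
  obtain ⟨L, hL, hq⟩ := exists_norm_eval_le ha hn hq
  refine ((integrable_inv_sq_add_sq ha).const_mul (K * L)).mono' ?_
    (Eventually.of_forall fun x => ?_)
  · apply Continuous.aestronglyMeasurable
    have : ∀ x : ℝ, (((x ^ 2 + a ^ 2) ^ n : ℝ) : ℂ) ≠ 0 := fun x =>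
      Complex.ofReal_ne_zero.2 (by positivity)
    have c : ∀ p : ℂ[X], Continuous fun x : ℝ => p.eval (x : ℂ) := fun p =>
      p.continuous.comp Complex.continuous_ofReal
    refine ((c p).mul (Complex.continuous_conj.comp (c q))).div ?_ this
    fun_prop
  · have h1 := hp x 0 le_rfl
    have h2 := hq x 0 le_rfl
    have h3 := norm_add_I_mul_sq a x 0
    simp only [Complex.ofReal_zero, zero_mul, add_zero, zero_add] at h1 h2 h3
    set t := ‖(x : ℂ) + Complex.I * (a : ℂ)‖
    have hpos : 0 < x ^ 2 + a ^ 2 := by positivity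
    rw [norm_div, norm_mul, RCLike.norm_conj, Complex.norm_real, Real.norm_of_nonneg (by positivity),
      div_le_iff₀ (by positivity)]
    calc _ ≤ (K * t ^ (n - 1)) * (L * t ^ (n - 1)) := by gcongr
      _ = K * L * (t ^ 2) ^ (n - 1) := by ring
      _ = _ := by
        rw [h3]
        obtain ⟨m, rfl⟩ := Nat.exists_eq_succ_of_ne_zero hn
        simp only [Nat.succ_eq_add_one, Nat.add_sub_cancel, pow_succ]
        field_simp

lemma polyPairing_sum_left {a : ℝ} (ha : 0 < a) {n : ℕ} (hn : n ≠ 0) {ι : Type*} (s : Finset ι)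
    (c : ι → ℂ) {p : ι → ℂ[X]} {q : ℂ[X]} (hp : ∀ i, p i ∈ degreeLT ℂ n)
    (hq : q ∈ degreeLT ℂ n) :
    polyPairing a n (∑ i ∈ s, c i • p i) q = ∑ i ∈ s, c i * polyPairing a n (p i) q := by
  simp only [polyPairing, ← integral_const_mul]
  rw [← integral_finsetSum _ fun i _ => (integrable_polyPairing ha hn (hp i) hq).const_mul _]
  congr 1
  ext x
  rw [eval_finsetSum, Finset.sum_mul, Finset.sum_div]
  refine Finset.sum_congr rfl fun i _ => ?_
  rw [eval_smul, smul_eq_mul]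
  ring

lemma polyPairing_conj (a : ℝ) (n : ℕ) (p q : ℂ[X]) :
    starRingEnd ℂ (polyPairing a n p q) = polyPairing a n q p := by
  simp only [polyPairing, ← integral_conj]
  congr 1
  ext x
  rw [map_div₀, map_mul, Complex.conj_conj, Complex.conj_ofReal, mul_comm]

lemma polyPairing_sum_right {a : ℝ} (ha : 0 < a) {n : ℕ} (hn : n ≠ 0) {ι : Type*} (s : Finset ι)
    (c : ι → ℂ) {p : ι → ℂ[X]} {q : ℂ[X]} (hp : ∀ i, p i ∈ degreeLT ℂ n)
    (hq : q ∈ degreeLT ℂ n) :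
    polyPairing a n q (∑ i ∈ s, c i • p i) =
      ∑ i ∈ s, starRingEnd ℂ (c i) * polyPairing a n q (p i) := by
  rw [← polyPairing_conj, polyPairing_sum_left ha hn s c hp hq, map_sum]
  simp_rw [map_mul, polyPairing_conj]

/-- An orthonormal family of `n` polynomials of degree less than `n` spans the polynomials of
degree less than `n`. -/
lemma exists_eq_sum_of_orthonormal {a : ℝ} (ha : 0 < a) {n : ℕ} (hn : n ≠ 0) {e : Fin n → ℂ[X]}
    (he : ∀ i, e i ∈ degreeLT ℂ n)
    (ho : ∀ i j, polyPairing a n (e i) (e j) = if i = j then 1 else 0) {q : ℂ[X]}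
    (hq : q ∈ degreeLT ℂ n) : ∃ c : Fin n → ℂ, q = ∑ i, c i • e i := by
  have hli : LinearIndependent ℂ (fun i => (⟨e i, he i⟩ : degreeLT ℂ n)) := by
    rw [Fintype.linearIndependent_iff]
    intro g hg i
    have hg' : ∑ j, g j • e j = 0 := by
      have := congrArg Subtype.val hg
      simpa using this
    have h := polyPairing_sum_left ha hn Finset.univ g he (he i)
    rw [hg'] at h
    simp only [ho, mul_ite, mul_one, mul_zero, Finset.sum_ite_eq', Finset.mem_univ, if_true] at h
    rw [← h]
    simp [polyPairing]
  have : FiniteDimensional ℂ (degreeLT ℂ n) := (degreeLTEquiv ℂ n).symm.finiteDimensional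
  have hspan := hli.span_eq_top_of_card_eq_finrank' (by
    rw [(degreeLTEquiv ℂ n).finrank_eq]; simp)
  have hmem : (⟨q, hq⟩ : degreeLT ℂ n) ∈
      Submodule.span ℂ (Set.range (fun i => (⟨e i, he i⟩ : degreeLT ℂ n))) := by
    rw [hspan]; trivial
  obtain ⟨c, hc⟩ := (Submodule.mem_span_range_iff_exists_fun ℂ).1 hmem
  refine ⟨c, ?_⟩
  have := congrArg Subtype.val hc
  simpa using this.symm

/-- Two orthonormal families of `n` polynomials of degree less than `n` have the same kernel. -/
lemma kernel_eq_of_orthonormal {a : ℝ} (ha : 0 < a) {n : ℕ} (hn : n ≠ 0) {e p : Fin n → ℂ[X]}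
    (he : ∀ i, e i ∈ degreeLT ℂ n) (hp : ∀ i, p i ∈ degreeLT ℂ n)
    (heo : ∀ i j, polyPairing a n (e i) (e j) = if i = j then 1 else 0)
    (hpo : ∀ i j, polyPairing a n (p i) (p j) = if i = j then 1 else 0) (x y : ℂ) :
    ∑ k, (p k).eval x * starRingEnd ℂ ((p k).eval y) =
      ∑ k, (e k).eval x * starRingEnd ℂ ((e k).eval y) := by
  choose U hU using fun k => exists_eq_sum_of_orthonormal ha hn he heo (hp k)
  set M : Matrix (Fin n) (Fin n) ℂ := Matrix.of U with hM
  have h1 : M * M.conjTranspose = 1 := by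
    ext k l
    rw [Matrix.mul_apply, Matrix.one_apply, ← hpo k l]
    conv_rhs => rw [hU k, polyPairing_sum_left ha hn _ _ he (hp l), hU l]
    refine Finset.sum_congr rfl fun j _ => ?_
    rw [polyPairing_sum_right ha hn _ _ he (he j)]
    simp [heo, hM]
  -- A one-sided inverse of a square matrix is two-sided: orthonormal rows give orthonormal columns,
  -- and it is the columns that enter the kernel sum.
  have h2 : M.conjTranspose * M = 1 := mul_eq_one_comm.1 h1
  have h3 : ∀ i j, ∑ k, U k i * starRingEnd ℂ (U k j) = if i = j then 1 else 0 := by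
    intro i j
    have := congrFun (congrFun h2 j) i
    rw [Matrix.mul_apply, Matrix.one_apply] at this
    simp only [hM, Matrix.conjTranspose_apply, Matrix.of_apply, RCLike.star_def] at this
    simp only [mul_comm (U _ i)]
    rw [this]
    simp [eq_comm]
  have h4 : ∀ k z, (p k).eval z = ∑ i, U k i * (e i).eval z := by
    intro k z
    conv_lhs => rw [hU k]
    simp [eval_finsetSum]
  simp_rw [h4, map_sum, map_mul, Finset.sum_mul_sum]
  rw [Finset.sum_comm]
  refine Finset.sum_congr rfl fun i _ => ?_
  rw [Finset.sum_comm]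
  have : ∀ j, ∑ k, U k i * (e i).eval x * (starRingEnd ℂ (U k j) * starRingEnd ℂ ((e j).eval y)) =
      (e i).eval x * starRingEnd ℂ ((e j).eval y) * if i = j then 1 else 0 := by
    intro j
    rw [← h3 i j, Finset.mul_sum]
    exact Finset.sum_congr rfl fun k _ => by ring
  simp [this]

/-! ### The Cayley basis and its orthonormality. -/

lemma integral_inv_sq_add_sq_univ {a : ℝ} (ha : 0 < a) :
    ∫ x : ℝ, (x ^ 2 + a ^ 2)⁻¹ = Real.pi / a := by
  have h := Measure.integral_comp_div (fun x : ℝ => (1 + x ^ 2)⁻¹) a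
  rw [integral_univ_inv_one_add_sq, abs_of_pos ha, smul_eq_mul] at h
  have e : ∀ x : ℝ, (x ^ 2 + a ^ 2)⁻¹ = (1 + (x / a) ^ 2)⁻¹ * (a ^ 2)⁻¹ := by
    intro x; field_simp; ring
  simp_rw [e]
  rw [integral_mul_const, h]
  field_simp

lemma tendsto_cayley (a : ℝ) {l : Filter ℝ} (hl : Tendsto (fun x : ℝ => ‖x‖) l atTop) :
    Tendsto (fun x : ℝ => ((x : ℂ) - Complex.I * a) / ((x : ℂ) + Complex.I * a)) l (𝓝 1) := by
  have h1 : Tendsto (fun x : ℝ => ‖(x : ℂ) + Complex.I * a‖) l atTop := by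
    have h : Tendsto (fun x : ℝ => ‖x‖ - ‖Complex.I * (a : ℂ)‖) l atTop :=
      tendsto_atTop_add_const_right _ _ hl
    refine tendsto_atTop_mono (fun x => ?_) h
    have := norm_sub_le ((x : ℂ) + Complex.I * a) (Complex.I * a)
    rw [add_sub_cancel_right, Complex.norm_real] at this
    linarith
  have h2 : Tendsto (fun x : ℝ => ((x : ℂ) + Complex.I * a)⁻¹) l (𝓝 0) := by
    rw [tendsto_zero_iff_norm_tendsto_zero]
    simp_rw [norm_inv]
    exact tendsto_inv_atTop_zero.comp h1
  have h3 := (h2.const_mul (-(2 * Complex.I * a))).const_add 1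
  rw [mul_zero, add_zero] at h3
  refine h3.congr' ?_
  filter_upwards [h1.eventually (eventually_gt_atTop 0)] with x hx
  have : (x : ℂ) + Complex.I * a ≠ 0 := norm_pos_iff.1 hx
  field_simp
  ring

lemma real_add_I_mul_ne_zero {a : ℝ} (ha : a ≠ 0) (x : ℝ) :
    (x : ℂ) + Complex.I * (a : ℂ) ≠ 0 ∧ (x : ℂ) - Complex.I * (a : ℂ) ≠ 0 := by
  constructor
  · intro h
    have := congrArg Complex.im h
    simp at this
    exact ha this
  · intro h
    have := congrArg Complex.im h
    simp at this
    exact ha this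

lemma real_sq_add_sq_eq (a x : ℝ) : ((x ^ 2 + a ^ 2 : ℝ) : ℂ) =
    ((x : ℂ) - Complex.I * a) * ((x : ℂ) + Complex.I * a) := by
  push_cast
  linear_combination ((a : ℂ) ^ 2) * Complex.I_sq

lemma norm_cayley {a : ℝ} (ha : a ≠ 0) (x : ℝ) :
    ‖((x : ℂ) - Complex.I * a) / ((x : ℂ) + Complex.I * a)‖ = 1 := by
  have : (x : ℂ) - Complex.I * a = starRingEnd ℂ ((x : ℂ) + Complex.I * a) := by
    simp [sub_eq_add_neg]
  rw [this, norm_div, RCLike.norm_conj, div_self]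
  exact norm_ne_zero_iff.2 (real_add_I_mul_ne_zero ha x).1

/-- With w = (x - ia) / (x + ia) one has w'/w = 2ia / (x² + a²), so w^m / (2iam) is a primitive. It
has the same limit at both ends of the line, because w tends to 1 there. -/
lemma integral_cayley_zpow {a : ℝ} (ha : 0 < a) {m : ℤ} (hm : m ≠ 0) :
    ∫ x : ℝ, (((x : ℂ) - Complex.I * a) / ((x : ℂ) + Complex.I * a)) ^ m *
      (((x ^ 2 + a ^ 2)⁻¹ : ℝ) : ℂ) = 0 := by
  have ha' : (a : ℂ) ≠ 0 := Complex.ofReal_ne_zero.2 ha.ne'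
  have hm' : (m : ℂ) ≠ 0 := Int.cast_ne_zero.2 hm
  set w : ℝ → ℂ := fun x => ((x : ℂ) - Complex.I * a) / ((x : ℂ) + Complex.I * a) with hw
  have hw0 : ∀ x, w x ≠ 0 := fun x =>
    div_ne_zero (real_add_I_mul_ne_zero ha.ne' x).2 (real_add_I_mul_ne_zero ha.ne' x).1
  have hd : ∀ x : ℝ, HasDerivAt (fun x => w x ^ m * (2 * Complex.I * a * m)⁻¹)
      (w x ^ m * (((x ^ 2 + a ^ 2)⁻¹ : ℝ) : ℂ)) x := by
    intro x
    obtain ⟨h1, h2⟩ := real_add_I_mul_ne_zero ha.ne' x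
    have hx : HasDerivAt (fun x : ℝ => (x : ℂ)) 1 x := Complex.ofRealCLM.hasDerivAt
    have hwd := (hx.sub_const (Complex.I * (a : ℂ))).div (hx.add_const (Complex.I * (a : ℂ))) h1
    have := ((hasDerivAt_zpow m (w x) (Or.inl (hw0 x))).comp x hwd).mul_const
      (2 * Complex.I * a * m)⁻¹
    refine this.congr_deriv ?_
    rw [zpow_sub_one₀ (hw0 x), Complex.ofReal_inv, real_sq_add_sq_eq]
    simp only [hw]
    field_simp
    ring
  have hint : Integrable (fun x : ℝ => w x ^ m * (((x ^ 2 + a ^ 2)⁻¹ : ℝ) : ℂ)) := by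
    refine (integrable_inv_sq_add_sq ha).mono' ?_ (Eventually.of_forall fun x => ?_)
    · apply Continuous.aestronglyMeasurable
      refine Continuous.mul ?_ (Complex.continuous_ofReal.comp ?_)
      · refine Continuous.zpow₀ ?_ m fun x => Or.inl (hw0 x)
        exact (by fun_prop : Continuous fun x : ℝ => (x : ℂ) - Complex.I * a).div (by fun_prop)
          fun x => (real_add_I_mul_ne_zero ha.ne' x).1
      · exact Continuous.inv₀ (by fun_prop) fun x => by positivity
    · rw [norm_mul, norm_zpow, norm_cayley ha.ne', one_zpow, one_mul, Complex.norm_real,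
        Real.norm_of_nonneg (by positivity)]
  have hlim : ∀ l : Filter ℝ, Tendsto (fun x : ℝ => ‖x‖) l atTop →
      Tendsto (fun x => w x ^ m * (2 * Complex.I * a * m)⁻¹) l (𝓝 (2 * Complex.I * a * m)⁻¹) := by
    intro l hl
    have := ((tendsto_cayley a hl).zpow₀ m (Or.inl one_ne_zero)).mul_const
      (2 * Complex.I * a * m)⁻¹
    rwa [one_zpow, one_mul] at this
  rw [integral_of_hasDerivAt_of_tendsto hd hint (hlim _ tendsto_abs_atBot_atTop)
    (hlim _ tendsto_abs_atTop_atTop), sub_self]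

/-- The orthonormal family `√(a/π) (z - ia)^j (z + ia)^(n-1-j)`. -/
noncomputable def cayleyBasis (a : ℝ) (n : ℕ) (j : Fin n) : ℂ[X] :=
  C (√(a / Real.pi) : ℂ) * ((X - C (Complex.I * a)) ^ (j : ℕ) *
    (X + C (Complex.I * a)) ^ (n - 1 - (j : ℕ)))

lemma eval_cayleyBasis (a : ℝ) (n : ℕ) (j : Fin n) (z : ℂ) :
    (cayleyBasis a n j).eval z = (√(a / Real.pi) : ℂ) * ((z - Complex.I * a) ^ (j : ℕ) *
      (z + Complex.I * a) ^ (n - 1 - (j : ℕ))) := by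
  simp [cayleyBasis]

lemma conj_eval_cayleyBasis (a : ℝ) (n : ℕ) (j : Fin n) (x : ℝ) :
    starRingEnd ℂ ((cayleyBasis a n j).eval (x : ℂ)) =
      (√(a / Real.pi) : ℂ) * (((x : ℂ) + Complex.I * a) ^ (j : ℕ) *
      ((x : ℂ) - Complex.I * a) ^ (n - 1 - (j : ℕ))) := by
  rw [eval_cayleyBasis]
  simp [sub_eq_add_neg]

lemma cayleyBasis_mem_degreeLT (a : ℝ) {n : ℕ} (j : Fin n) :
    cayleyBasis a n j ∈ degreeLT ℂ n := by
  have hj := j.2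
  rw [mem_degreeLT]
  refine lt_of_le_of_lt (b := ((n - 1 : ℕ) : WithBot ℕ)) (natDegree_le_iff_degree_le.1 ?_) ?_
  · refine (natDegree_C_mul_le _ _).trans (natDegree_mul_le.trans ?_)
    have h1 : natDegree ((X - C (Complex.I * (a : ℂ))) ^ (j : ℕ)) ≤ j :=
      (natDegree_pow_le).trans (by rw [natDegree_X_sub_C, mul_one])
    have h2 : natDegree ((X + C (Complex.I * (a : ℂ))) ^ (n - 1 - (j : ℕ))) ≤ n - 1 - j :=
      (natDegree_pow_le).trans (by rw [natDegree_X_add_C, mul_one])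
    omega
  · exact_mod_cast (by omega : n - 1 < n)

/-- Conjugation on the real line swaps x - ia and x + ia, so the weighted product collapses to (a/π)
w^(j-k) / (x² + a²) with w the Cayley quotient. The diagonal integral π/a explains the factor
√(a/π). -/
lemma polyPairing_cayleyBasis {a : ℝ} (ha : 0 < a) {n : ℕ} (j k : Fin n) :
    polyPairing a n (cayleyBasis a n j) (cayleyBasis a n k) = if j = k then 1 else 0 := by
  have hc : (√(a / Real.pi) : ℂ) * (√(a / Real.pi) : ℂ) = ((a / Real.pi : ℝ) : ℂ) := by
    rw [← Complex.ofReal_mul, Real.mul_self_sqrt (by positivity)]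
  have key : polyPairing a n (cayleyBasis a n j) (cayleyBasis a n k) =
      ((a / Real.pi : ℝ) : ℂ) * ∫ x : ℝ,
        (((x : ℂ) - Complex.I * a) / ((x : ℂ) + Complex.I * a)) ^ ((j : ℤ) - (k : ℤ)) *
        (((x ^ 2 + a ^ 2)⁻¹ : ℝ) : ℂ) := by
    rw [polyPairing, ← integral_const_mul]
    congr 1
    ext x
    rw [eval_cayleyBasis, conj_eval_cayleyBasis, ← hc, Complex.ofReal_pow, Complex.ofReal_inv,
      real_sq_add_sq_eq]
    obtain ⟨h1, h2⟩ := real_add_I_mul_ne_zero ha.ne' x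
    set A := (x : ℂ) - Complex.I * a
    set B := (x : ℂ) + Complex.I * a
    set s := (√(a / Real.pi) : ℂ)
    have hj : n = (n - 1 - (j : ℕ)) + j + 1 := by have := j.2; omega
    have hk : n = (n - 1 - (k : ℕ)) + k + 1 := by have := k.2; omega
    have e1 : (A * B) ^ n = A ^ (n - 1 - (k : ℕ)) * A ^ (k : ℕ) * A *
        (B ^ (n - 1 - (j : ℕ)) * B ^ (j : ℕ) * B) := by
      have eA : A ^ n = A ^ (n - 1 - (k : ℕ)) * A ^ (k : ℕ) * A := by
        rw [← pow_add, ← pow_succ, ← hk]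
      have eB : B ^ n = B ^ (n - 1 - (j : ℕ)) * B ^ (j : ℕ) * B := by
        rw [← pow_add, ← pow_succ, ← hj]
      rw [mul_pow, eA, eB]
    rw [e1, zpow_sub₀ (div_ne_zero h2 h1), zpow_natCast, zpow_natCast, div_pow, div_pow]
    field_simp
  rw [key]
  split_ifs with h
  · subst h
    simp only [sub_self, zpow_zero, one_mul]
    rw [integral_complex_ofReal, integral_inv_sq_add_sq_univ ha, ← Complex.ofReal_mul,
      ← Complex.ofReal_one]
    congr 1
    field_simp
  · rw [integral_cayley_zpow ha, mul_zero]
    have : (j : ℕ) ≠ k := fun h' => h (Fin.ext h')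
    omega

/-! ### The kernel in the angular coordinate. -/

lemma tan_sub_I {a t : ℝ} (ht : Real.cos t ≠ 0) :
    ((a * Real.tan t : ℝ) : ℂ) - Complex.I * a =
      ((a / Real.cos t : ℝ) : ℂ) * (-Complex.I * Complex.exp (t * Complex.I)) ∧
    ((a * Real.tan t : ℝ) : ℂ) + Complex.I * a =
      ((a / Real.cos t : ℝ) : ℂ) * (Complex.I * Complex.exp (-(t * Complex.I))) := by
  have ht' : (Real.cos t : ℂ) ≠ 0 := Complex.ofReal_ne_zero.2 ht
  rw [← neg_mul, ← Complex.ofReal_neg, Complex.exp_mul_I, Complex.exp_mul_I,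
    ← Complex.ofReal_cos, ← Complex.ofReal_sin, ← Complex.ofReal_cos, ← Complex.ofReal_sin,
    Real.cos_neg, Real.sin_neg, Real.tan_eq_sin_div_cos]
  push_cast at ht' ⊢
  constructor
  · field_simp
    linear_combination (a * Complex.sin t) * Complex.I_sq
  · field_simp
    linear_combination (a * Complex.sin t) * Complex.I_sq

/-- This is (x^n - y^n) / (x - y) with x = e^(iδ) and y = e^(-iδ), kept in product form so that sin
δ may vanish. -/
lemma sum_exp_dirichlet {n : ℕ} (δ : ℝ) :
    (∑ j ∈ Finset.range n, Complex.exp (δ * Complex.I) ^ j *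
      Complex.exp (-(δ * Complex.I)) ^ (n - 1 - j)) * (Real.sin δ : ℂ) = (Real.sin (n * δ) : ℂ) := by
  have h := (Commute.all (Complex.exp (δ * Complex.I)) (Complex.exp (-(δ * Complex.I)))).geom_sum₂_mul n
  rw [← Complex.exp_nat_mul, ← Complex.exp_nat_mul] at h
  rw [Complex.ofReal_sin, Complex.ofReal_sin, Complex.sin, Complex.sin]
  push_cast
  simp only [neg_mul, mul_neg] at h ⊢
  rw [mul_assoc (n : ℂ)]
  linear_combination (-Complex.I / 2) * h

/-- The unimodular constants ±i of `tan_sub_I` cancel between the two points, and only the phase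
difference s - t survives next to the moduli a / cos. -/
lemma kernel_cayleyBasis {a : ℝ} (ha : 0 < a) {n : ℕ} {s t : ℝ}
    (hs : Real.cos s ≠ 0) (ht : Real.cos t ≠ 0) :
    ∑ j, (cayleyBasis a n j).eval ((a * Real.tan s : ℝ) : ℂ) *
        starRingEnd ℂ ((cayleyBasis a n j).eval ((a * Real.tan t : ℝ) : ℂ)) =
      ((a / Real.pi * (a / Real.cos s * (a / Real.cos t)) ^ (n - 1) : ℝ) : ℂ) *
      ∑ j ∈ Finset.range n, Complex.exp ((s - t : ℝ) * Complex.I) ^ j *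
        Complex.exp (-((s - t : ℝ) * Complex.I)) ^ (n - 1 - j) := by
  have hc : (√(a / Real.pi) : ℂ) * (√(a / Real.pi) : ℂ) = ((a / Real.pi : ℝ) : ℂ) := by
    rw [← Complex.ofReal_mul, Real.mul_self_sqrt (by positivity)]
  rw [← Fin.sum_univ_eq_sum_range (fun j => Complex.exp ((s - t : ℝ) * Complex.I) ^ j *
        Complex.exp (-((s - t : ℝ) * Complex.I)) ^ (n - 1 - j)) n, Finset.mul_sum]
  refine Finset.sum_congr rfl fun j _ => ?_
  rw [eval_cayleyBasis, conj_eval_cayleyBasis, (tan_sub_I hs).1, (tan_sub_I hs).2,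
    (tan_sub_I ht).1, (tan_sub_I ht).2, Complex.ofReal_mul, ← hc, Complex.ofReal_pow,
    Complex.ofReal_mul]
  set p := ((a / Real.cos s : ℝ) : ℂ)
  set q := ((a / Real.cos t : ℝ) : ℂ)
  set m := n - 1 - (j : ℕ) with hm
  have e1 : Complex.exp ((s - t : ℝ) * Complex.I) =
      Complex.exp (s * Complex.I) * Complex.exp (-(t * Complex.I)) := by
    rw [← Complex.exp_add]; congr 1; push_cast; ring
  have e2 : Complex.exp (-((s - t : ℝ) * Complex.I)) =
      Complex.exp (-(s * Complex.I)) * Complex.exp (t * Complex.I) := by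
    rw [← Complex.exp_add]; congr 1; push_cast; ring
  have e3 : n - 1 = j + m := by have := j.2; omega
  have e4 : -Complex.I * Complex.I = 1 := by simp
  rw [e1, e2, e3]
  have e5 : (-Complex.I) ^ (j : ℕ) * Complex.I ^ (j : ℕ) = 1 := by rw [← mul_pow, e4, one_pow]
  have e6 : (-Complex.I) ^ m * Complex.I ^ m = 1 := by rw [← mul_pow, e4, one_pow]
  simp only [mul_pow, pow_add]
  set c := (√(a / Real.pi) : ℂ)
  linear_combination (c * c * p ^ (j : ℕ) * p ^ m * q ^ (j : ℕ) * q ^ m *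
    (Complex.exp (s * Complex.I) ^ (j : ℕ) * Complex.exp (-(t * Complex.I)) ^ (j : ℕ) *
      Complex.exp (-(s * Complex.I)) ^ m * Complex.exp (t * Complex.I) ^ m)) *
      ((-Complex.I) ^ m * Complex.I ^ m * e5 + e6)

/-! ### The space H(E) as the polynomials of degree less than n. -/

/-- The mean value property over a circle, with the angle in (-π, π) to match the target of polar
coordinates. -/
lemma enorm_mul_two_pi_le_lintegral_circle {F : ℂ → ℂ} (hF : Differentiable ℂ F) (c : ℂ) (r : ℝ) :
    ‖F c‖ₑ * ENNReal.ofReal (2 * Real.pi) ≤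
      ∫⁻ θ in Set.Ioo (-Real.pi) Real.pi, ‖F (circleMap c r θ)‖ₑ := by
  have h1 : Real.circleAverage F c r = F c :=
    (hF.diffContOnCl (s := Metric.ball c |r|)).circleAverage
  rw [Real.circleAverage_def] at h1
  have hper : Function.Periodic (fun θ => F (circleMap c r θ)) (2 * Real.pi) := fun θ => by
    simp only [periodic_circleMap c r θ]
  have h2 := hper.intervalIntegral_add_eq 0 (-Real.pi)
  rw [zero_add, show -Real.pi + 2 * Real.pi = Real.pi by ring] at h2
  rw [h2, intervalIntegral.integral_of_le (by linarith [Real.pi_pos]),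
    integral_Ioc_eq_integral_Ioo] at h1
  have h3 : F c * ((2 * Real.pi : ℝ) : ℂ) =
      ∫ θ in Set.Ioo (-Real.pi) Real.pi, F (circleMap c r θ) := by
    rw [← h1, Complex.real_smul, mul_comm, ← mul_assoc, ← Complex.ofReal_mul,
      mul_inv_cancel₀ (by positivity), Complex.ofReal_one, one_mul]
  have h4 : ‖F c‖ₑ * ENNReal.ofReal (2 * Real.pi) = ‖F c * ((2 * Real.pi : ℝ) : ℂ)‖ₑ := by
    rw [enorm_mul, ← ofReal_norm (((2 * Real.pi : ℝ) : ℂ)), Complex.norm_real,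
      Real.norm_of_nonneg (by positivity)]
  rw [h4, h3]
  exact enorm_integral_le_lintegral_enorm _

/-- The area form of the sub-mean value property. -/
lemma enorm_mul_area_le_lintegral_ball {F : ℂ → ℂ} (hF : Differentiable ℂ F) (c : ℂ) {R : ℝ}
    (hR : 0 < R) :
    ‖F c‖ₑ * ENNReal.ofReal (Real.pi * R ^ 2) ≤ ∫⁻ w in Metric.ball c R, ‖F w‖ₑ := by
  have hm : Measurable fun p : ℝ × ℝ => ‖F (circleMap c p.1 p.2)‖ₑ := by
    have : Continuous fun p : ℝ × ℝ => F (circleMap c p.1 p.2) :=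
      hF.continuous.comp (by simp only [circleMap]; fun_prop)
    exact this.enorm.measurable
  have h1 : ∫⁻ w in Metric.ball c R, ‖F w‖ₑ =
      ∫⁻ p in Set.Ioi (0 : ℝ) ×ˢ Set.Ioo (-Real.pi) Real.pi, ENNReal.ofReal p.1 *
        ((Set.Iio R).indicator (fun _ => 1) p.1 * ‖F (circleMap c p.1 p.2)‖ₑ) := by
    rw [← lintegral_indicator Metric.isOpen_ball.measurableSet,
      ← lintegral_add_left_eq_self _ c, ← Complex.lintegral_comp_polarCoord_symm,
      polarCoord_target]
    refine setLIntegral_congr_fun (measurableSet_Ioi.prod measurableSet_Ioo) ?_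
    rintro ⟨r, θ⟩ hp
    have hr : 0 < r := hp.1
    have hcm : c + Complex.polarCoord.symm (r, θ) = circleMap c r θ := by
      rw [Complex.polarCoord_symm_apply, circleMap, Complex.exp_mul_I]
      simp
    simp only [smul_eq_mul, hcm]
    congr 1
    by_cases hrR : r < R
    · rw [Set.indicator_of_mem, Set.indicator_of_mem (show r ∈ Set.Iio R from hrR), one_mul]
      rw [Metric.mem_ball, dist_eq_norm, circleMap_sub_center, norm_circleMap_zero, abs_of_pos hr]
      exact hrR
    · rw [Set.indicator_of_notMem, Set.indicator_of_notMem (show r ∉ Set.Iio R from hrR), zero_mul]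
      rw [Metric.mem_ball, dist_eq_norm, circleMap_sub_center, norm_circleMap_zero, abs_of_pos hr]
      exact hrR
  have hind : Measurable ((Set.Iio R).indicator (fun _ => (1 : ℝ≥0∞))) :=
    measurable_const.indicator measurableSet_Iio
  rw [h1, Measure.volume_eq_prod, ← Measure.prod_restrict, lintegral_prod _ (by fun_prop)]
  calc ‖F c‖ₑ * ENNReal.ofReal (Real.pi * R ^ 2)
      = ∫⁻ r in Set.Ioo 0 R, ENNReal.ofReal r * (‖F c‖ₑ * ENNReal.ofReal (2 * Real.pi)) := by
        rw [lintegral_mul_const _ (by fun_prop), ← ofReal_integral_eq_lintegral_ofReal]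
        · rw [← integral_Ioc_eq_integral_Ioo, ← intervalIntegral.integral_of_le hR.le, integral_id,
            mul_comm (ENNReal.ofReal _), mul_assoc, ← ENNReal.ofReal_mul (by positivity)]
          congr 2
          ring
        · exact (continuous_id.integrableOn_Icc).mono_set Set.Ioo_subset_Icc_self
        · exact (ae_restrict_mem measurableSet_Ioo).mono fun r hr => hr.1.le
    _ = ∫⁻ r in Set.Ioi 0, ENNReal.ofReal r * ((Set.Iio R).indicator (fun _ => 1) r *
          (‖F c‖ₑ * ENNReal.ofReal (2 * Real.pi))) := by
        rw [← lintegral_indicator measurableSet_Ioo, ← lintegral_indicator measurableSet_Ioi]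
        congr 1
        ext r
        by_cases h0 : 0 < r <;> by_cases hrR : r < R <;>
          simp [Set.indicator, h0, hrR]
    _ ≤ _ := by
        refine lintegral_mono fun r => ?_
        simp only
        have hmr : Measurable fun θ : ℝ => ‖F (circleMap c r θ)‖ₑ := by
          have : Continuous fun θ : ℝ => F (circleMap c r θ) :=
            hF.continuous.comp (continuous_circleMap c r)
          exact this.enorm.measurable
        rw [lintegral_const_mul _ (hmr.const_mul _), lintegral_const_mul _ hmr]
        gcongr
        exact enorm_mul_two_pi_le_lintegral_circle hF c r

/-- An entire function with suitable `L²` bounds on horizontal segments is bounded by a power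
of `|z|`. -/
lemma enorm_sq_mul_le_of_horizontal {f : ℂ → ℂ} (hf : Differentiable ℂ f) {B : ℝ≥0∞} {R : ℝ}
    (hR : 0 < R)
    (hB : ∀ y : ℝ, y ≠ 0 → |y| < 2 * R →
      ∫⁻ x in Set.Ioo (-(2 * R)) (2 * R), ‖f ((x : ℂ) + (y : ℂ) * Complex.I)‖ₑ ^ 2 ≤ B)
    {c : ℂ} (hc : ‖c‖ ≤ R) :
    ‖f c‖ₑ ^ 2 * ENNReal.ofReal (Real.pi * R ^ 2) ≤ ENNReal.ofReal (4 * R) * B := by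
  have h1 := enorm_mul_area_le_lintegral_ball (hf.pow 2) c hR
  simp only [Pi.pow_apply, enorm_pow] at h1
  refine h1.trans ?_
  -- Since ‖c‖ ≤ R, the disc of radius R about c lies in the square of half-side 2R about the
  -- origin, where Fubini reduces the area integral to horizontal segments.
  set S : Set (ℝ × ℝ) := Set.Ioo (-(2 * R)) (2 * R) ×ˢ Set.Ioo (-(2 * R)) (2 * R) with hS
  have hsub : Metric.ball c R ⊆ Complex.measurableEquivRealProd ⁻¹' S := by
    intro z hz
    have hz' : ‖z‖ < 2 * R := by
      have : ‖z - c‖ < R := by rwa [← dist_eq_norm]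
      calc ‖z‖ = ‖(z - c) + c‖ := by ring_nf
        _ ≤ ‖z - c‖ + ‖c‖ := norm_add_le _ _
        _ < _ := by linarith
    have h1 := abs_lt.1 ((Complex.abs_re_le_norm z).trans_lt hz')
    have h2 := abs_lt.1 ((Complex.abs_im_le_norm z).trans_lt hz')
    exact ⟨h1, h2⟩
  refine (lintegral_mono_set hsub).trans ?_
  have h2 := (Complex.volume_preserving_equiv_real_prod).setLIntegral_comp_preimage_emb
    Complex.measurableEquivRealProd.measurableEmbedding
    (fun p : ℝ × ℝ => ‖f ((p.1 : ℂ) + (p.2 : ℂ) * Complex.I)‖ₑ ^ 2) S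
  simp only [Complex.measurableEquivRealProd_apply, Complex.re_add_im] at h2
  have hm : Measurable fun p : ℝ × ℝ => ‖f ((p.1 : ℂ) + (p.2 : ℂ) * Complex.I)‖ₑ ^ 2 := by
    have : Continuous fun p : ℝ × ℝ => f ((p.1 : ℂ) + (p.2 : ℂ) * Complex.I) :=
      hf.continuous.comp (by fun_prop)
    exact this.enorm.measurable.pow_const 2
  rw [h2, hS, Measure.volume_eq_prod, ← Measure.prod_restrict, lintegral_prod_symm _ hm.aemeasurable]
  have hae : ∀ᵐ y : ℝ ∂(volume.restrict (Set.Ioo (-(2 * R)) (2 * R))),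
      ∫⁻ x in Set.Ioo (-(2 * R)) (2 * R), ‖f ((x : ℂ) + (y : ℂ) * Complex.I)‖ₑ ^ 2 ≤ B := by
    -- No bound is assumed on the real axis itself, which is a null set of heights.
    have h0 : ∀ᵐ y : ℝ ∂(volume.restrict (Set.Ioo (-(2 * R)) (2 * R))), y ≠ 0 :=
      Measure.ae_ne _ _
    filter_upwards [h0, ae_restrict_mem measurableSet_Ioo] with y hy hy'
    exact hB y hy (abs_lt.2 hy')
  refine (lintegral_mono_ae hae).trans ?_
  rw [lintegral_const, Measure.restrict_apply MeasurableSet.univ, Set.univ_inter, Real.volume_Ioo,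
    mul_comm]
  gcongr
  linarith

/-- An entire function of growth `O(R ^ (n - 1/2))` is a polynomial of degree less than `n`. -/
lemma exists_polynomial_of_growth {f : ℂ → ℂ} (hf : Differentiable ℂ f) {n : ℕ} {K R₀ : ℝ}
    (hK : ∀ R : ℝ, R₀ ≤ R → ∀ z : ℂ, ‖z‖ ≤ R → ‖f z‖ ^ 2 * R ≤ K * R ^ (2 * n)) :
    ∃ q ∈ degreeLT ℂ n, ∀ z, f z = q.eval z := by
  have hvan : ∀ m, n ≤ m → iteratedDeriv m f 0 = 0 := by
    intro m hm
    by_contra hne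
    have hpos : 0 < ‖iteratedDeriv m f 0‖ := norm_pos_iff.2 hne
    set d := ‖iteratedDeriv m f 0‖ with hd
    -- Cauchy's estimate on the circle of radius R, with m ≥ n: the half power missing from the
    -- growth leaves a factor R on the left and nothing on the right.
    have hbound : ∀ R : ℝ, max R₀ 1 ≤ R → d ^ 2 * R ≤ (m.factorial : ℝ) ^ 2 * |K| := by
      intro R hR
      have hR1 : 1 ≤ R := (le_max_right _ _).trans hR
      have hR0 : 0 < R := by linarith
      have h1 : ∀ z ∈ Metric.sphere (0 : ℂ) R, ‖f z‖ ≤ √(|K| * R ^ (2 * n) / R) := by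
        intro z hz
        apply Real.le_sqrt_of_sq_le
        rw [le_div_iff₀ hR0]
        refine (hK R ((le_max_left _ _).trans hR) z (by simpa using (mem_sphere_zero_iff_norm.1 hz).le)).trans ?_
        gcongr
        exact le_abs_self K
      have h2 := Complex.norm_iteratedDeriv_le_of_forall_mem_sphere_norm_le m hR0
        (hf.diffContOnCl) h1
      have h3 : d ^ 2 ≤ ((m.factorial : ℝ) * √(|K| * R ^ (2 * n) / R) / R ^ m) ^ 2 := by
        gcongr
      rw [div_pow, mul_pow, Real.sq_sqrt (by positivity), le_div_iff₀ (by positivity), ← pow_mul,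
        mul_comm m 2] at h3
      have h4 : R ^ (2 * n) ≤ R ^ (2 * m) := pow_le_pow_right₀ hR1 (by omega)
      have h5 : 0 < R ^ (2 * m) := by positivity
      have h6 : (m.factorial : ℝ) ^ 2 * (|K| * R ^ (2 * n) / R) * R ≤
          (m.factorial : ℝ) ^ 2 * |K| * R ^ (2 * m) := by
        have : (m.factorial : ℝ) ^ 2 * (|K| * R ^ (2 * n) / R) * R =
          (m.factorial : ℝ) ^ 2 * |K| * R ^ (2 * n) := by field_simp
        rw [this]
        gcongr
      have h7 : (d ^ 2 * R) * R ^ (2 * m) ≤ ((m.factorial : ℝ) ^ 2 * |K|) * R ^ (2 * m) := by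
        calc (d ^ 2 * R) * R ^ (2 * m) = (d ^ 2 * R ^ (2 * m)) * R := by ring
          _ ≤ _ := by gcongr
          _ ≤ _ := h6
      exact le_of_mul_le_mul_right h7 h5
    set M := (m.factorial : ℝ) ^ 2 * |K|
    -- At this radius d²R is at least M + d², beyond the bound M.
    have := hbound (max (max R₀ 1) (M / d ^ 2 + 1)) (le_max_left _ _)
    have h8 : d ^ 2 * (M / d ^ 2 + 1) ≤ M := by
      refine le_trans ?_ this
      gcongr
      exact le_max_right _ _
    have h9 : d ^ 2 * (M / d ^ 2 + 1) = M + d ^ 2 := by field_simp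
    rw [h9] at h8
    have : 0 < d ^ 2 := by positivity
    linarith
  refine ⟨∑ m ∈ Finset.range n, C ((m.factorial : ℂ)⁻¹ * iteratedDeriv m f 0) * X ^ m, ?_, ?_⟩
  · refine Submodule.sum_mem _ fun m hm => ?_
    rw [mem_degreeLT]
    exact (degree_C_mul_X_pow_le _ _).trans_lt (by exact_mod_cast Finset.mem_range.1 hm)
  · intro z
    have h := Complex.hasSum_taylorSeries_of_entire hf 0 z
    have h' := hasSum_sum_of_ne_finset_zero (L := .unconditional ℕ) (s := Finset.range n)
      (f := fun m : ℕ => ((m.factorial : ℂ)⁻¹ • (z - 0) ^ m • iteratedDeriv m f 0)) (fun m hm => by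
        rw [hvan m (by simpa using hm)]; simp)
    rw [h.unique h', eval_finsetSum]
    refine Finset.sum_congr rfl fun m _ => ?_
    simp
    ring

/-- The quotient is O(1 / |z + ia|), and |x + iy + ia|² ≥ x² + a² for y > 0 makes the L² bound
uniform in y. -/
lemma memHardyTwo_eval_div {a : ℝ} (ha : 0 < a) {n : ℕ} (hn : n ≠ 0) {q : ℂ[X]}
    (hq : q ∈ degreeLT ℂ n) :
    MemHardyTwo (fun z => q.eval z / (z + Complex.I * (a : ℂ)) ^ n) := by
  obtain ⟨K, hK, hb⟩ := exists_norm_eval_le ha hn hq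
  refine ⟨?_, ?_⟩
  · refine DifferentiableOn.div q.differentiable.differentiableOn (by fun_prop) fun z hz => ?_
    refine pow_ne_zero _ fun h => ?_
    have := congrArg Complex.im h
    simp at this
    have hz : 0 < z.im := hz
    linarith
  · have hfin : ∫⁻ x : ℝ, ENNReal.ofReal (K ^ 2 * (x ^ 2 + a ^ 2)⁻¹) ≠ ⊤ := by
      have := ((integrable_inv_sq_add_sq ha).const_mul (K ^ 2)).lintegral_lt_top
      exact this.ne
    refine ⟨(∫⁻ x : ℝ, ENNReal.ofReal (K ^ 2 * (x ^ 2 + a ^ 2)⁻¹)).toNNReal, fun y hy => ?_⟩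
    rw [ENNReal.coe_toNNReal hfin]
    refine lintegral_mono fun x => ?_
    have h1 := hb x y hy.le
    have h2 := norm_add_I_mul_sq a x y
    set w := ((x : ℂ) + (y : ℂ) * Complex.I) + Complex.I * (a : ℂ)
    have h3 : x ^ 2 + a ^ 2 ≤ ‖w‖ ^ 2 := by rw [h2]; nlinarith [mul_pos hy ha]
    have h4 : 0 < ‖w‖ ^ 2 := lt_of_lt_of_le (by positivity) h3
    have h5 : 0 < ‖w‖ := by
      rcases (norm_nonneg w).eq_or_lt with h | h
      · rw [← h] at h4; simp at h4
      · exact h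
    rw [← ofReal_norm, ← ENNReal.ofReal_pow (norm_nonneg _)]
    refine ENNReal.ofReal_le_ofReal ?_
    rw [norm_div, norm_pow, div_pow]
    obtain ⟨m, rfl⟩ := Nat.exists_eq_succ_of_ne_zero hn
    simp only [Nat.succ_eq_add_one, Nat.add_sub_cancel] at h1 ⊢
    calc _ ≤ (K * ‖w‖ ^ m) ^ 2 / (‖w‖ ^ (m + 1)) ^ 2 := by gcongr
      _ = K ^ 2 * (‖w‖ ^ 2)⁻¹ := by
        field_simp
        ring
      _ ≤ _ := by gcongr

lemma sharp_eval (q : ℂ[X]) (z : ℂ) :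
    sharp (fun z => q.eval z) z = (q.map (starRingEnd ℂ)).eval z := by
  rw [sharp, eval_map, eval₂_eq_sum_range, eval_eq_sum_range, map_sum]
  simp

lemma memDeBranges_pow_iff {a : ℝ} (ha : 0 < a) {n : ℕ} (hn : n ≠ 0) (f : ℂ → ℂ) :
    MemDeBranges (fun z => (z + Complex.I * (a : ℂ)) ^ n) f ↔
      ∃ q ∈ degreeLT ℂ n, ∀ z, f z = q.eval z := by
  constructor
  · rintro ⟨hf, ⟨-, C₁, h1⟩, ⟨-, C₂, h2⟩⟩
    set D : ℝ≥0 := C₁ + C₂ with hD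
    have hbd : ∀ (g : ℂ → ℂ) (C : ℝ≥0), C ≤ D → (∀ y : ℝ, 0 < y → ∫⁻ x : ℝ,
        ‖g ((x : ℂ) + (y : ℂ) * Complex.I) /
          (((x : ℂ) + (y : ℂ) * Complex.I) + Complex.I * (a : ℂ)) ^ n‖ₑ ^ 2 ≤ (C : ℝ≥0∞)) →
        ∀ R : ℝ, a ≤ R → ∀ y : ℝ, 0 < y → |y| < 2 * R →
          ∫⁻ x in Set.Ioo (-(2 * R)) (2 * R), ‖g ((x : ℂ) + (y : ℂ) * Complex.I)‖ₑ ^ 2 ≤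
            ENNReal.ofReal ((5 * R) ^ (2 * n)) * (D : ℝ≥0∞) := by
      intro g C hC hg R hR y hy hyR
      have hR0 : 0 < R := ha.trans_le hR
      calc _ ≤ ∫⁻ x in Set.Ioo (-(2 * R)) (2 * R), ENNReal.ofReal ((5 * R) ^ (2 * n)) *
            ‖g ((x : ℂ) + (y : ℂ) * Complex.I) /
              (((x : ℂ) + (y : ℂ) * Complex.I) + Complex.I * (a : ℂ)) ^ n‖ₑ ^ 2 := by
            refine setLIntegral_mono' measurableSet_Ioo fun x hx => ?_
            have h2 := norm_add_I_mul_sq a x y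
            set z := (x : ℂ) + (y : ℂ) * Complex.I
            set w := z + Complex.I * (a : ℂ) with hw
            rw [abs_of_pos hy] at hyR
            have hw0 : w ≠ 0 := by
              intro h0
              rw [h0] at h2
              simp at h2
              nlinarith [sq_nonneg x, mul_pos hy ha]
            -- As |x|, |y| < 2R and a ≤ R, one has |w|² ≤ 4R² + 9R²; the constant 5 is merely
            -- convenient.
            have hw5 : ‖w‖ ≤ 5 * R := by
              rw [← sq_le_sq₀ (norm_nonneg _) (by positivity), h2]
              nlinarith [hx.1, hx.2]
            rw [← ofReal_norm, ← ofReal_norm, ← ENNReal.ofReal_pow (norm_nonneg _),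
              ← ENNReal.ofReal_pow (norm_nonneg _), ← ENNReal.ofReal_mul (by positivity)]
            refine ENNReal.ofReal_le_ofReal ?_
            rw [norm_div, norm_pow, div_pow, ← pow_mul, mul_comm n 2]
            have hp : 0 < ‖w‖ ^ (2 * n) := by positivity
            rw [mul_div_assoc', le_div_iff₀ hp, mul_comm]
            gcongr
        _ ≤ ∫⁻ x : ℝ, ENNReal.ofReal ((5 * R) ^ (2 * n)) *
            ‖g ((x : ℂ) + (y : ℂ) * Complex.I) /
              (((x : ℂ) + (y : ℂ) * Complex.I) + Complex.I * (a : ℂ)) ^ n‖ₑ ^ 2 :=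
            setLIntegral_le_lintegral _ _
        _ ≤ _ := by
            rw [lintegral_const_mul' _ _ ENNReal.ofReal_ne_top]
            gcongr
            exact (hg y hy).trans (by exact_mod_cast hC)
    have hboth : ∀ R : ℝ, a ≤ R → ∀ y : ℝ, y ≠ 0 → |y| < 2 * R →
        ∫⁻ x in Set.Ioo (-(2 * R)) (2 * R), ‖f ((x : ℂ) + (y : ℂ) * Complex.I)‖ₑ ^ 2 ≤
          ENNReal.ofReal ((5 * R) ^ (2 * n)) * (D : ℝ≥0∞) := by
      intro R hR y hy hyR
      rcases lt_or_gt_of_ne hy with hneg | hpos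
      · have := hbd (sharp f) C₂ (by simp [hD]) h2 R hR (-y) (by linarith) (by rwa [abs_neg])
        refine le_trans (le_of_eq ?_) this
        congr 1
        ext x
        congr 1
        rw [sharp, ← ofReal_norm, ← ofReal_norm, RCLike.norm_conj]
        congr 3
        simp
      · exact hbd f C₁ (by simp [hD]) h1 R hR y hpos hyR
    refine exists_polynomial_of_growth hf (R₀ := a)
      (K := 4 * 5 ^ (2 * n) * D / Real.pi) fun R hR z hz => ?_
    have hR0 : 0 < R := ha.trans_le hR
    have h := enorm_sq_mul_le_of_horizontal hf hR0 (hboth R hR) hz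
    rw [← ofReal_norm, ← ENNReal.ofReal_pow (norm_nonneg _),
      ← ENNReal.ofReal_mul (by positivity), ← ENNReal.ofReal_coe_nnreal (p := D),
      ← ENNReal.ofReal_mul (by positivity), ← ENNReal.ofReal_mul (by positivity),
      ENNReal.ofReal_le_ofReal_iff (by positivity), mul_pow] at h
    have hπ := Real.pi_pos
    rw [div_mul_eq_mul_div, le_div_iff₀ hπ]
    refine le_of_mul_le_mul_right ?_ hR0
    calc _ = ‖f z‖ ^ 2 * (Real.pi * R ^ 2) := by ring
      _ ≤ _ := h
      _ = _ := by ring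
  · rintro ⟨q, hq, hf⟩
    obtain rfl : f = fun z => q.eval z := funext hf
    refine ⟨q.differentiable, memHardyTwo_eval_div ha hn hq, ?_⟩
    simp_rw [sharp_eval]
    refine memHardyTwo_eval_div ha hn ?_
    rw [mem_degreeLT] at hq ⊢
    exact (degree_map_le).trans_lt hq

/-! ### Existence of orthonormal polynomials and the basis property. -/

lemma integral_poissonPowMeasure {a : ℝ} (ha : 0 < a) (n : ℕ) (g : ℝ → ℝ) :
    ∫ x, g x ∂(poissonPowMeasure a n) = ∫ x, g x / (x ^ 2 + a ^ 2) ^ n := by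
  rw [poissonPowMeasure, integral_withDensity_eq_integral_toReal_smul (by fun_prop)
    (Eventually.of_forall fun x => ENNReal.ofReal_lt_top)]
  congr 1
  ext x
  rw [ENNReal.toReal_ofReal (by positivity), smul_eq_mul, div_eq_inv_mul]

lemma eval_map_ofReal (p : ℝ[X]) (x : ℝ) :
    (p.map Complex.ofRealHom).eval (x : ℂ) = ((p.eval x : ℝ) : ℂ) := by
  rw [eval_map, ← Complex.ofRealHom_eq_coe x, eval₂_hom, Complex.ofRealHom_eq_coe]

lemma polyPairing_map_ofReal {a : ℝ} (ha : 0 < a) (n : ℕ) (p q : ℝ[X]) :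
    polyPairing a n (p.map Complex.ofRealHom) (q.map Complex.ofRealHom) =
      ((∫ x, p.eval x * q.eval x ∂(poissonPowMeasure a n) : ℝ) : ℂ) := by
  rw [integral_poissonPowMeasure ha, ← integral_complex_ofReal, polyPairing]
  congr 1
  ext x
  rw [eval_map_ofReal, eval_map_ofReal, Complex.conj_ofReal]
  push_cast
  rfl

lemma map_mem_degreeLT {n : ℕ} {p : ℝ[X]} (hp : p ∈ degreeLT ℝ n) :
    p.map Complex.ofRealHom ∈ degreeLT ℂ n := by
  rw [mem_degreeLT] at hp ⊢
  exact degree_map_le.trans_lt hp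

lemma integrable_eval_mul_eval {a : ℝ} (ha : 0 < a) {n : ℕ} (hn : n ≠ 0) {p q : ℝ[X]}
    (hp : p ∈ degreeLT ℝ n) (hq : q ∈ degreeLT ℝ n) :
    Integrable (fun x => p.eval x * q.eval x / (x ^ 2 + a ^ 2) ^ n) := by
  have h := (integrable_polyPairing ha hn (map_mem_degreeLT hp) (map_mem_degreeLT hq)).re
  refine h.congr (Eventually.of_forall fun x => ?_)
  simp only [eval_map_ofReal, Complex.conj_ofReal]
  rw [← Complex.ofReal_mul, ← Complex.ofReal_div]
  exact Complex.ofReal_re _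

/-- A continuous nonnegative integrand with zero integral vanishes everywhere, so the polynomial
would have every real number as a root. -/
lemma integral_eval_sq_pos {a : ℝ} (ha : 0 < a) {n : ℕ} (hn : n ≠ 0) {p : ℝ[X]}
    (hp : p ∈ degreeLT ℝ n) (h0 : p ≠ 0) :
    0 < ∫ x, p.eval x * p.eval x ∂(poissonPowMeasure a n) := by
  rw [integral_poissonPowMeasure ha]
  have hnn : ∀ x : ℝ, 0 ≤ p.eval x * p.eval x / (x ^ 2 + a ^ 2) ^ n := fun x =>
    div_nonneg (mul_self_nonneg _) (by positivity)
  refine lt_of_le_of_ne (integral_nonneg hnn) fun h => h0 ?_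
  have h1 := (integral_eq_zero_iff_of_nonneg hnn (integrable_eval_mul_eval ha hn hp hp)).1 h.symm
  have hc : Continuous fun x : ℝ => p.eval x * p.eval x / (x ^ 2 + a ^ 2) ^ n :=
    (p.continuous.mul p.continuous).div (by fun_prop) fun x => by positivity
  have h2 := (hc.ae_eq_iff_eq volume (g := 0) continuous_const).1 h1
  refine Polynomial.funext fun x => ?_
  have h3 := congrFun h2 x
  have h4 : (x ^ 2 + a ^ 2) ^ n ≠ 0 := by positivity
  simpa [h4] using h3

lemma exists_isOrthonormalPolynomials {a : ℝ} (ha : 0 < a) {n : ℕ} (hn : n ≠ 0) :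
    ∃ p : Fin n → ℝ[X], IsOrthonormalPolynomials (poissonPowMeasure a n) p := by
  -- Gram-Schmidt on the monomials. The family is indexed by ℕ, with irrelevant values from m on, so
  -- that the induction never changes its type.
  have key : ∀ m ≤ n, ∃ p : ℕ → ℝ[X],
      (∀ k < m, (p k).natDegree = k ∧ 0 < (p k).leadingCoeff) ∧
      ∀ j < m, ∀ k < m, ∫ x, (p j).eval x * (p k).eval x ∂(poissonPowMeasure a n) =
        if j = k then 1 else 0 := by
    intro m
    induction m with
    | zero => exact fun _ => ⟨fun _ => 0, by simp, by simp⟩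
    | succ m ih =>
      intro hm
      obtain ⟨p, hdeg, ho⟩ := ih (by omega)
      set I : ℝ[X] → ℝ[X] → ℝ := fun u v => ∫ x, u.eval x * v.eval x ∂(poissonPowMeasure a n)
        with hI
      have hpdeg : ∀ k < m, (p k).degree < m := fun k hk =>
        (degree_le_of_natDegree_le (hdeg k hk).1.le).trans_lt (by exact_mod_cast hk)
      have hmn : ((m : ℕ) : WithBot ℕ) < n := by exact_mod_cast (by omega : m < n)
      have hpmem : ∀ k < m, p k ∈ degreeLT ℝ n := fun k hk =>
        mem_degreeLT.2 ((hpdeg k hk).trans hmn)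
      set s : ℝ[X] := ∑ j ∈ Finset.range m, C (I (X ^ m) (p j)) * p j with hs
      have hsdeg : s.degree < m := by
        rw [← mem_degreeLT]
        refine Submodule.sum_mem _ fun j hj => ?_
        rw [← smul_eq_C_mul]
        exact Submodule.smul_mem _ _ (mem_degreeLT.2 (hpdeg j (Finset.mem_range.1 hj)))
      have hsX : s.degree < (X ^ m : ℝ[X]).degree := by rwa [degree_X_pow]
      set q : ℝ[X] := X ^ m - s with hq
      -- The subtracted projection has degree below m, so the residual stays monic; hence it is
      -- nonzero, and scaling by c > 0 makes c the leading coefficient.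
      have hqmonic : q.Monic := (monic_X_pow m).sub_of_left hsX
      have hqdeg : q.degree = m := by
        rw [hq, degree_sub_eq_left_of_degree_lt hsX, degree_X_pow]
      have hqmem : q ∈ degreeLT ℝ n := mem_degreeLT.2 (hqdeg ▸ hmn)
      have hXmem : (X ^ m : ℝ[X]) ∈ degreeLT ℝ n := mem_degreeLT.2 (by rwa [degree_X_pow])
      have hqo : ∀ k < m, I q (p k) = 0 := by
        intro k hk
        have h1 : I q (p k) = I (X ^ m) (p k) -
            ∑ j ∈ Finset.range m, I (X ^ m) (p j) * I (p j) (p k) := by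
          simp only [hI, integral_poissonPowMeasure ha]
          simp_rw [← integral_const_mul]
          rw [← integral_finsetSum, ← integral_sub]
          · congr 1
            ext x
            rw [hq, eval_sub, hs, eval_finsetSum, sub_mul, sub_div, Finset.sum_mul,
              Finset.sum_div]
            congr 1
            refine Finset.sum_congr rfl fun j _ => ?_
            rw [eval_mul, eval_C]
            simp only [hI, integral_poissonPowMeasure ha]
            ring
          · exact integrable_eval_mul_eval ha hn hXmem (hpmem k hk)
          · exact integrable_finsetSum _ fun j hj =>
              (integrable_eval_mul_eval ha hn (hpmem j (Finset.mem_range.1 hj))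
                (hpmem k hk)).const_mul _
          · exact fun j hj => (integrable_eval_mul_eval ha hn (hpmem j (Finset.mem_range.1 hj))
                (hpmem k hk)).const_mul _
        rw [h1, Finset.sum_eq_single k]
        · simp [hI, ho k hk k hk]
        · intro j hj hjk
          simp [hI, ho j (Finset.mem_range.1 hj) k hk, hjk]
        · intro h; exact absurd (Finset.mem_range.2 hk) h
      have hqq : 0 < I q q := integral_eval_sq_pos ha hn hqmem hqmonic.ne_zero
      set c : ℝ := (√(I q q))⁻¹ with hc
      have hc0 : 0 < c := by positivity
      have hcc : c * c * I q q = 1 := by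
        rw [hc, ← mul_inv, Real.mul_self_sqrt hqq.le, inv_mul_cancel₀ hqq.ne']
      have hqk : ∀ k < m, ∫ x, (C c * q).eval x * (p k).eval x ∂(poissonPowMeasure a n) = 0 := by
        intro k hk
        simp_rw [eval_mul, eval_C, mul_assoc, integral_const_mul]
        have := hqo k hk
        simp only [hI] at this
        rw [this, mul_zero]
      refine ⟨fun k => if k = m then C c * q else p k, ?_, ?_⟩
      · intro k hk
        rcases eq_or_ne k m with rfl | hkm
        · simp only [if_true]
          refine ⟨?_, ?_⟩
          · rw [natDegree_C_mul hc0.ne', natDegree_eq_of_degree_eq_some hqdeg]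
          · rw [leadingCoeff_mul, leadingCoeff_C, hqmonic.leadingCoeff, mul_one]
            exact hc0
        · simp only [hkm, if_false]
          exact hdeg k (by omega)
      · intro j hj k hk
        rcases eq_or_ne j m with hjm | hjm <;> rcases eq_or_ne k m with hkm | hkm
        · simp only [hjm, hkm, if_true]
          have : ∀ x : ℝ, (C c * q).eval x * (C c * q).eval x =
              c * c * (q.eval x * q.eval x) := fun x => by rw [eval_mul, eval_C]; ring
          simp_rw [this, integral_const_mul]
          exact hcc
        · simp only [hjm, if_true, hkm, if_false, hkm.symm]
          exact hqk k (by omega)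
        · simp only [hkm, if_true, hjm, if_false]
          simp_rw [mul_comm ((p j).eval _)]
          exact hqk j (by omega)
        · simp only [hjm, hkm, if_false]
          exact ho j (by omega) k (by omega)
  obtain ⟨p, h1, h2⟩ := key n le_rfl
  refine ⟨fun k => p k, fun k => h1 k k.2, fun j k => ?_⟩
  rw [h2 j j.2 k k.2]
  simp [Fin.ext_iff]

lemma IsOrthonormalPolynomials.mem_degreeLT {μ : Measure ℝ} {n : ℕ} {p : Fin n → ℝ[X]}
    (hp : IsOrthonormalPolynomials μ p) (k : Fin n) : p k ∈ degreeLT ℝ n :=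
  Polynomial.mem_degreeLT.2 ((degree_le_of_natDegree_le (hp.1 k).1.le).trans_lt
    (by exact_mod_cast k.2))

lemma IsOrthonormalPolynomials.polyPairing_map {a : ℝ} (ha : 0 < a) {n : ℕ} {p : Fin n → ℝ[X]}
    (hp : IsOrthonormalPolynomials (poissonPowMeasure a n) p) (j k : Fin n) :
    polyPairing a n ((p j).map Complex.ofRealHom) ((p k).map Complex.ofRealHom) =
      if j = k then 1 else 0 := by
  rw [polyPairing_map_ofReal ha, hp.2 j k]
  split_ifs <;> simp

lemma deBrangesInner_pow_eval {a : ℝ} (n : ℕ) (p q : ℂ[X]) :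
    deBrangesInner (fun z => (z + Complex.I * (a : ℂ)) ^ n) (fun z => p.eval z)
      (fun z => q.eval z) = polyPairing a n p q := by
  rw [deBrangesInner, polyPairing]
  congr 1
  ext x
  have h := norm_add_I_mul_sq a x 0
  simp only [Complex.ofReal_zero, zero_mul, add_zero, zero_add] at h
  rw [norm_pow, ← pow_mul, mul_comm n 2, pow_mul, h]

lemma IsOrthonormalPolynomials.isDeBrangesOrthonormalBasis {a : ℝ} (ha : 0 < a) {n : ℕ}
    (hn : n ≠ 0) {p : Fin n → ℝ[X]}
    (hp : IsOrthonormalPolynomials (poissonPowMeasure a n) p) :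
    IsDeBrangesOrthonormalBasis (fun z => (z + Complex.I * (a : ℂ)) ^ n)
      (fun k z => aeval z (p k)) := by
  have he : ∀ k : Fin n, (fun z : ℂ => aeval z (p k)) =
      fun z => ((p k).map Complex.ofRealHom).eval z := by
    intro k
    ext z
    rw [eval_map, aeval_def]
    rfl
  refine ⟨fun j k => ?_, fun f => ?_⟩
  · beta_reduce
    rw [he j, he k, deBrangesInner_pow_eval, hp.polyPairing_map ha]
  · rw [memDeBranges_pow_iff ha hn]
    have hm := fun k => map_mem_degreeLT (hp.mem_degreeLT k)
    constructor
    · rintro ⟨q, hq, hf⟩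
      obtain ⟨c, rfl⟩ := exists_eq_sum_of_orthonormal ha hn hm (hp.polyPairing_map ha) hq
      refine ⟨c, fun z => ?_⟩
      rw [hf z, eval_finsetSum]
      refine Finset.sum_congr rfl fun k _ => ?_
      rw [eval_smul, smul_eq_mul, ← congrFun (he k) z]
    · rintro ⟨c, hf⟩
      refine ⟨∑ k, c k • (p k).map Complex.ofRealHom,
        Submodule.sum_mem _ fun k _ => Submodule.smul_mem _ _ (hm k), fun z => ?_⟩
      rw [hf z, eval_finsetSum]
      refine Finset.sum_congr rfl fun k _ => ?_
      rw [eval_smul, smul_eq_mul, ← congrFun (he k) z]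

/-! ### Variance and correlation of the random polynomial. -/

lemma IsOrthonormalPolynomials.sum_eval_mul_eval {a : ℝ} (ha : 0 < a) {n : ℕ}
    (hn : n ≠ 0) {p : Fin n → ℝ[X]}
    (hp : IsOrthonormalPolynomials (poissonPowMeasure a n) p) {s t : ℝ} (hs : Real.cos s ≠ 0)
    (ht : Real.cos t ≠ 0) :
    ((∑ k, (p k).eval (a * Real.tan s) * (p k).eval (a * Real.tan t) : ℝ) : ℂ) =
      ((a / Real.pi * (a / Real.cos s * (a / Real.cos t)) ^ (n - 1) : ℝ) : ℂ) *
      ∑ j ∈ Finset.range n, Complex.exp ((s - t : ℝ) * Complex.I) ^ j *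
        Complex.exp (-((s - t : ℝ) * Complex.I)) ^ (n - 1 - j) := by
  have h := kernel_eq_of_orthonormal ha hn (cayleyBasis_mem_degreeLT a)
    (fun k => map_mem_degreeLT (hp.mem_degreeLT k)) (polyPairing_cayleyBasis ha)
    (hp.polyPairing_map ha) ((a * Real.tan s : ℝ) : ℂ) ((a * Real.tan t : ℝ) : ℂ)
  rw [kernel_cayleyBasis ha hs ht] at h
  rw [← h]
  simp only [eval_map_ofReal, Complex.conj_ofReal]
  push_cast
  rfl

/-- The standard deviation of the random polynomial at `a * tan s`. -/
noncomputable def kernelDiagSqrt (a : ℝ) (n : ℕ) (s : ℝ) : ℝ :=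
  √(n * (a / Real.pi)) * (a / Real.cos s) ^ (n - 1)

lemma kernelDiagSqrt_pos {a : ℝ} (ha : 0 < a) {n : ℕ} (hn : n ≠ 0) {s : ℝ}
    (hs : 0 < Real.cos s) : 0 < kernelDiagSqrt a n s := by
  have : (0 : ℝ) < n := by positivity
  rw [kernelDiagSqrt]
  positivity

lemma kernelDiagSqrt_mul {a : ℝ} (ha : 0 < a) (n : ℕ) (s t : ℝ) :
    kernelDiagSqrt a n s * kernelDiagSqrt a n t =
      n * (a / Real.pi * (a / Real.cos s * (a / Real.cos t)) ^ (n - 1)) := by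
  rw [kernelDiagSqrt, kernelDiagSqrt, mul_mul_mul_comm, Real.mul_self_sqrt (by positivity),
    ← mul_pow]
  ring

/-- The diagonal of the kernel of the orthonormal polynomials. -/
lemma IsOrthonormalPolynomials.sum_sq_eval {a : ℝ} (ha : 0 < a) {n : ℕ}
    (hn : n ≠ 0) {p : Fin n → ℝ[X]}
    (hp : IsOrthonormalPolynomials (poissonPowMeasure a n) p) {s : ℝ} (hs : Real.cos s ≠ 0) :
    ∑ k, (p k).eval (a * Real.tan s) ^ 2 = kernelDiagSqrt a n s ^ 2 := by
  have h := hp.sum_eval_mul_eval ha hn hs hs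
  simp only [sub_self, Complex.ofReal_zero, zero_mul, neg_zero, Complex.exp_zero, one_pow, mul_one,
    Finset.sum_const, Finset.card_range, nsmul_eq_mul] at h
  rw [sq, kernelDiagSqrt_mul ha]
  simp_rw [sq]
  have h' : ((∑ k, (p k).eval (a * Real.tan s) * (p k).eval (a * Real.tan s) : ℝ) : ℂ) =
      ((n * (a / Real.pi * (a / Real.cos s * (a / Real.cos s)) ^ (n - 1)) : ℝ) : ℂ) := by
    rw [h, Complex.ofReal_mul (n : ℝ), Complex.ofReal_natCast, mul_comm]
  exact Complex.ofReal_injective h'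

/-- The correlation of the random polynomial at `a * tan s` and `a * tan t`. -/
lemma IsOrthonormalPolynomials.sum_mul_eval {a : ℝ} (ha : 0 < a) {n : ℕ}
    (hn : n ≠ 0) {p : Fin n → ℝ[X]}
    (hp : IsOrthonormalPolynomials (poissonPowMeasure a n) p) {s t : ℝ} (hs : Real.cos s ≠ 0)
    (ht : Real.cos t ≠ 0) (hst : Real.sin (s - t) ≠ 0) :
    ∑ k, (p k).eval (a * Real.tan s) * (p k).eval (a * Real.tan t) =
      Real.sin (n * (s - t)) / (n * Real.sin (s - t)) *
        (kernelDiagSqrt a n s * kernelDiagSqrt a n t) := by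
  have h := hp.sum_eval_mul_eval ha hn hs ht
  have hd := sum_exp_dirichlet (n := n) (s - t)
  have hn' : (n : ℝ) ≠ 0 := by positivity
  rw [kernelDiagSqrt_mul ha]
  set w := a / Real.pi * (a / Real.cos s * (a / Real.cos t)) ^ (n - 1)
  have h1 : (∑ k, (p k).eval (a * Real.tan s) * (p k).eval (a * Real.tan t)) *
      Real.sin (s - t) = w * Real.sin (n * (s - t)) := by
    apply Complex.ofReal_injective
    rw [Complex.ofReal_mul, h, mul_assoc, hd, ← Complex.ofReal_mul]
  field_simp
  linear_combination h1

/-! ### Sign-change probability of a Gaussian pair. -/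

lemma gaussian_prod_eq_withDensity :
    (gaussianReal 0 1).prod (gaussianReal 0 1) =
      (volume : Measure (ℝ × ℝ)).withDensity
        (fun p => ENNReal.ofReal ((2 * Real.pi)⁻¹ * Real.exp (-(p.1 ^ 2 + p.2 ^ 2) / 2))) := by
  rw [gaussianReal_of_var_ne_zero _ one_ne_zero, prod_withDensity (by fun_prop) (by fun_prop),
    Measure.volume_eq_prod]
  congr 1
  ext p
  rw [gaussianPDF, gaussianPDF, ← ENNReal.ofReal_mul (gaussianPDFReal_nonneg _ _ _),
    gaussianPDFReal, gaussianPDFReal]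
  congr 1
  have : (√(2 * Real.pi))⁻¹ * (√(2 * Real.pi))⁻¹ = (2 * Real.pi)⁻¹ := by
    rw [← mul_inv, Real.mul_self_sqrt (by positivity)]
  simp only [NNReal.coe_one, mul_one, sub_zero]
  rw [mul_mul_mul_comm, this, ← Real.exp_add]
  congr 2
  ring

/-- For a cone S with angle set A, the polar integral splits because the density depends on r alone.
-/
lemma gaussian_prod_cone {S : Set (ℝ × ℝ)} (hS : MeasurableSet S) {A : Set ℝ}
    (hA : MeasurableSet A)
    (h : ∀ r θ : ℝ, 0 < r → ((r * Real.cos θ, r * Real.sin θ) ∈ S ↔ θ ∈ A)) :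
    (gaussianReal 0 1).prod (gaussianReal 0 1) S =
      (∫⁻ r in Set.Ioi (0 : ℝ), ENNReal.ofReal r *
        ENNReal.ofReal ((2 * Real.pi)⁻¹ * Real.exp (-(r ^ 2) / 2))) *
        volume (A ∩ Set.Ioo (-Real.pi) Real.pi) := by
  rw [gaussian_prod_eq_withDensity, withDensity_apply _ hS, ← lintegral_indicator hS,
    ← lintegral_comp_polarCoord_symm, polarCoord_target]
  have h1 : ∀ p ∈ Set.Ioi (0 : ℝ) ×ˢ Set.Ioo (-Real.pi) Real.pi,
      ENNReal.ofReal p.1 • S.indicator (fun p : ℝ × ℝ => ENNReal.ofReal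
        ((2 * Real.pi)⁻¹ * Real.exp (-(p.1 ^ 2 + p.2 ^ 2) / 2))) (polarCoord.symm p) =
      (ENNReal.ofReal p.1 * ENNReal.ofReal ((2 * Real.pi)⁻¹ * Real.exp (-(p.1 ^ 2) / 2))) *
        A.indicator 1 p.2 := by
    rintro ⟨r, θ⟩ hp
    have hr : 0 < r := hp.1
    simp only [polarCoord_symm_apply, smul_eq_mul, mul_assoc]
    by_cases hθ : θ ∈ A
    · rw [Set.indicator_of_mem ((h r θ hr).2 hθ), Set.indicator_of_mem hθ]
      simp only [Pi.one_apply, mul_one]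
      congr 5
      have := Real.sin_sq_add_cos_sq θ
      linear_combination (-r ^ 2) * this
    · rw [Set.indicator_of_notMem (fun h' => hθ ((h r θ hr).1 h')), Set.indicator_of_notMem hθ]
      simp
  rw [setLIntegral_congr_fun (measurableSet_Ioi.prod measurableSet_Ioo) h1,
    Measure.volume_eq_prod, ← Measure.prod_restrict,
    lintegral_prod_mul (f := fun r : ℝ => ENNReal.ofReal r *
      ENNReal.ofReal ((2 * Real.pi)⁻¹ * Real.exp (-(r ^ 2) / 2))) (by fun_prop)
      (measurable_one.indicator hA).aemeasurable]
  congr 1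
  rw [lintegral_indicator_one hA, Measure.restrict_apply hA]

lemma gaussian_prod_cone_eq {S : Set (ℝ × ℝ)} (hS : MeasurableSet S) {A : Set ℝ}
    (hA : MeasurableSet A)
    (h : ∀ r θ : ℝ, 0 < r → ((r * Real.cos θ, r * Real.sin θ) ∈ S ↔ θ ∈ A)) :
    (gaussianReal 0 1).prod (gaussianReal 0 1) S =
      (ENNReal.ofReal (2 * Real.pi))⁻¹ * volume (A ∩ Set.Ioo (-Real.pi) Real.pi) := by
  rw [gaussian_prod_cone hS hA h]
  congr 1
  -- The radial constant is never integrated: the cone formula for the whole plane, of mass 1,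
  -- determines it.
  have h2 := gaussian_prod_cone MeasurableSet.univ MeasurableSet.univ
    (fun r θ _ => by simp)
  rw [measure_univ, Set.univ_inter, Real.volume_Ioo] at h2
  rw [show Real.pi - -Real.pi = 2 * Real.pi by ring] at h2
  exact ENNReal.eq_inv_of_mul_eq_one_left h2.symm

/-- In polar coordinates the two factors are r cos θ and r cos(θ - α). They have opposite signs on
two arcs of length α, out of a total of 2π. -/
lemma gaussian_prod_sign_change {α : ℝ} (h0 : 0 < α) (h1 : α < Real.pi / 2) :
    (gaussianReal 0 1).prod (gaussianReal 0 1)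
      {p | p.1 * (Real.cos α * p.1 + Real.sin α * p.2) < 0} = ENNReal.ofReal (α / Real.pi) := by
  have hA : MeasurableSet {θ : ℝ | Real.cos θ * Real.cos (θ - α) < 0} :=
    measurableSet_lt (by fun_prop) (by fun_prop)
  rw [gaussian_prod_cone_eq (measurableSet_lt (by fun_prop) (by fun_prop)) hA]
  · have hset : {θ : ℝ | Real.cos θ * Real.cos (θ - α) < 0} ∩ Set.Ioo (-Real.pi) Real.pi =
        Set.Ioo (-(Real.pi / 2)) (α - Real.pi / 2) ∪ Set.Ioo (Real.pi / 2) (α + Real.pi / 2) := by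
      ext θ
      simp only [Set.mem_inter_iff, Set.mem_ofPred_eq, Set.mem_Ioo, Set.mem_union]
      constructor
      · rintro ⟨h, h2, h3⟩
        by_contra! hcon
        obtain ⟨hc1, hc2⟩ := hcon
        rcases le_or_gt θ (-(Real.pi / 2)) with h4 | h4
        · have e1 : Real.cos θ ≤ 0 := by
            rw [← Real.cos_neg]
            exact Real.cos_nonpos_of_pi_div_two_le_of_le (by linarith) (by linarith)
          have e2 : Real.cos (θ - α) ≤ 0 := by
            rw [← Real.cos_neg]
            exact Real.cos_nonpos_of_pi_div_two_le_of_le (by linarith) (by linarith)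
          nlinarith
        · have h5 := hc1 h4
          rcases le_or_gt θ (Real.pi / 2) with h6 | h6
          · have e1 : 0 ≤ Real.cos θ := Real.cos_nonneg_of_neg_pi_div_two_le_of_le h4.le h6
            have e2 : 0 ≤ Real.cos (θ - α) :=
              Real.cos_nonneg_of_neg_pi_div_two_le_of_le (by linarith) (by linarith)
            nlinarith
          · have h7 := hc2 h6
            have e1 : Real.cos θ ≤ 0 :=
              Real.cos_nonpos_of_pi_div_two_le_of_le (by linarith) (by linarith)
            have e2 : Real.cos (θ - α) ≤ 0 :=
              Real.cos_nonpos_of_pi_div_two_le_of_le (by linarith) (by linarith)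
            nlinarith
      · rintro (⟨h2, h3⟩ | ⟨h2, h3⟩)
        · refine ⟨?_, by linarith, by linarith⟩
          have e1 : 0 < Real.cos θ := Real.cos_pos_of_mem_Ioo ⟨h2, by linarith⟩
          have e2 : Real.cos (θ - α) < 0 := by
            rw [← Real.cos_neg]
            exact Real.cos_neg_of_pi_div_two_lt_of_lt (by linarith) (by linarith)
          exact mul_neg_of_pos_of_neg e1 e2
        · refine ⟨?_, by linarith, by linarith⟩
          have e1 : Real.cos θ < 0 :=
            Real.cos_neg_of_pi_div_two_lt_of_lt h2 (by linarith)
          have e2 : 0 < Real.cos (θ - α) := Real.cos_pos_of_mem_Ioo ⟨by linarith, by linarith⟩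
          exact mul_neg_of_neg_of_pos e1 e2
    rw [hset, measure_union _ measurableSet_Ioo, Real.volume_Ioo, Real.volume_Ioo,
      ← ENNReal.ofReal_add (by linarith) (by linarith), ← ENNReal.ofReal_inv_of_pos (by positivity),
      ← ENNReal.ofReal_mul (by positivity)]
    · congr 1
      field_simp
      ring
    · rw [Set.disjoint_left]
      rintro x ⟨h2, h3⟩ ⟨h4, h5⟩
      linarith
  · intro r θ hr
    simp only [Set.mem_ofPred_eq]
    have : r * Real.cos θ * (Real.cos α * (r * Real.cos θ) + Real.sin α * (r * Real.sin θ)) =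
        r ^ 2 * (Real.cos θ * Real.cos (θ - α)) := by rw [Real.cos_sub]; ring
    rw [this]
    have : 0 < r ^ 2 := by positivity
    constructor
    · intro h
      by_contra! h'
      nlinarith [mul_nonneg this.le h']
    · intro h
      exact mul_neg_of_pos_of_neg this h

lemma hasLaw_eval_pi_gaussian {n : ℕ} (k : Fin n) :
    HasLaw (fun c : Fin n → ℝ => c k) (gaussianReal 0 1)
      (Measure.pi (fun _ => gaussianReal 0 1)) :=
  (measurePreserving_eval (fun _ : Fin n => gaussianReal 0 1) k).hasLaw

lemma measurable_linear_pi {n : ℕ} (u : Fin n → ℝ) :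
    Measurable (fun c : Fin n → ℝ => ∑ k, c k * u k) := by fun_prop

lemma hasGaussianLaw_linear_pi {n : ℕ} (u w : Fin n → ℝ) :
    HasGaussianLaw (fun c : Fin n → ℝ => (∑ k, c k * u k, ∑ k, c k * w k))
      (Measure.pi (fun _ => gaussianReal 0 1)) := by
  have h : HasGaussianLaw (fun c : Fin n → ℝ => (fun k => c k))
      (Measure.pi (fun _ => gaussianReal 0 1)) :=
    iIndepFun.hasGaussianLaw (X := fun k (c : Fin n → ℝ) => c k)
      (fun k => (hasLaw_eval_pi_gaussian k).hasGaussianLaw)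
      (iIndepFun_pi (X := fun _ => id) (fun _ => aemeasurable_id))
  let l (v : Fin n → ℝ) : (Fin n → ℝ) →L[ℝ] ℝ :=
    ∑ k, (v k) • ContinuousLinearMap.proj (R := ℝ) (φ := fun _ : Fin n => ℝ) k
  have hl : ∀ v c, l v c = ∑ k, c k * v k := by
    intro v c
    simp [l, mul_comm]
  have := h.map_fun ((l u).prod (l w))
  simpa [hl] using this

lemma integral_linear_pi {n : ℕ} (u : Fin n → ℝ) :
    ∫ c : Fin n → ℝ, ∑ k, c k * u k ∂(Measure.pi (fun _ => gaussianReal 0 1)) = 0 := by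
  have hL : ∀ k : Fin n, HasLaw (fun c : Fin n → ℝ => c k) (gaussianReal 0 1)
    (Measure.pi (fun _ => gaussianReal 0 1)) := hasLaw_eval_pi_gaussian
  rw [integral_finsetSum _ fun k _ => ((hL k).hasGaussianLaw.integrable).mul_const _]
  refine Finset.sum_eq_zero fun k _ => ?_
  rw [integral_mul_const, (hL k).integral_eq, integral_id_gaussianReal, zero_mul]

lemma covariance_linear_pi {n : ℕ} (u w : Fin n → ℝ) :
    cov[fun c : Fin n → ℝ => ∑ k, c k * u k, fun c => ∑ k, c k * w k;
      Measure.pi (fun _ => gaussianReal 0 1)] = ∑ k, u k * w k := by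
  have hL : ∀ k : Fin n, HasLaw (fun c : Fin n → ℝ => c k) (gaussianReal 0 1)
    (Measure.pi (fun _ => gaussianReal 0 1)) := hasLaw_eval_pi_gaussian
  have hm : ∀ (v : Fin n → ℝ) k, MemLp (fun c : Fin n → ℝ => c k * v k) 2
    (Measure.pi (fun _ => gaussianReal 0 1)) := fun v k =>
      ((hL k).hasGaussianLaw.memLp_two).mul_const _
  have hI : iIndepFun (fun k (c : Fin n → ℝ) => c k) (Measure.pi (fun _ => gaussianReal 0 1)) :=
    iIndepFun_pi (X := fun _ => id) (fun _ => aemeasurable_id)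
  rw [covariance_fun_sum_fun_sum (hm u) (hm w)]
  refine Finset.sum_congr rfl fun j _ => ?_
  rw [Finset.sum_eq_single j]
  · rw [covariance_mul_const_left, covariance_mul_const_right,
      covariance_self (hL j).aemeasurable, (hL j).variance_eq, variance_id_gaussianReal]
    simp
    ring
  · intro k _ hkj
    rw [covariance_mul_const_left, covariance_mul_const_right,
      (hI.indepFun hkj.symm).covariance_eq_zero (hL j).hasGaussianLaw.memLp_two
        (hL k).hasGaussianLaw.memLp_two]
    simp
  · simp

/-- Jointly Gaussian uncorrelated variables are independent, so orthonormal u and w give a standard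
Gaussian pair. -/
lemma map_linear_pi_eq {n : ℕ} {u w : Fin n → ℝ} (hu : ∑ k, u k ^ 2 = 1) (hw : ∑ k, w k ^ 2 = 1)
    (h : ∑ k, u k * w k = 0) :
    (Measure.pi (fun _ => gaussianReal 0 1)).map
      (fun c : Fin n → ℝ => (∑ k, c k * u k, ∑ k, c k * w k)) =
      (gaussianReal 0 1).prod (gaussianReal 0 1) := by
  have hG := hasGaussianLaw_linear_pi u w
  have hI := hG.indepFun_of_covariance_eq_zero ((covariance_linear_pi u w).trans h)
  have hv : ∀ v : Fin n → ℝ, ∑ k, v k ^ 2 = 1 →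
      HasGaussianLaw (fun c : Fin n → ℝ => ∑ k, c k * v k)
        (Measure.pi (fun _ => gaussianReal 0 1)) →
      (Measure.pi (fun _ => gaussianReal 0 1)).map (fun c : Fin n → ℝ => ∑ k, c k * v k) =
        gaussianReal 0 1 := by
    intro v hv hg
    rw [hg.map_eq_gaussianReal, integral_linear_pi, ← covariance_self (measurable_linear_pi v).aemeasurable,
      covariance_linear_pi]
    simp [← pow_two, hv]
  rw [(indepFun_iff_map_prod_eq_prod_map_map (measurable_linear_pi u).aemeasurable
    (measurable_linear_pi w).aemeasurable).1 hI,
    hv u hu hG.fst, hv w hw hG.snd]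

/-- The probability that two standard Gaussians with positive correlation `r` have opposite
signs. -/
lemma pi_gaussian_sign_change {n : ℕ} {u v : Fin n → ℝ} {A B r : ℝ} (hA : 0 < A) (hB : 0 < B)
    (hu : ∑ k, u k ^ 2 = A ^ 2) (hv : ∑ k, v k ^ 2 = B ^ 2) (huv : ∑ k, u k * v k = r * (A * B))
    (h0 : 0 < r) (h1 : r < 1) :
    Measure.pi (fun _ => gaussianReal 0 1)
      {c : Fin n → ℝ | (∑ k, c k * u k) * (∑ k, c k * v k) < 0} =
      ENNReal.ofReal (Real.arccos r / Real.pi) := by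
  have hα0 : 0 < Real.arccos r := Real.arccos_pos.2 h1
  have hα1 : Real.arccos r < Real.pi / 2 := Real.arccos_lt_pi_div_two.2 h0
  have hs : 0 < Real.sin (Real.arccos r) :=
    Real.sin_pos_of_pos_of_lt_pi hα0 (by linarith [Real.pi_pos])
  have hc : Real.cos (Real.arccos r) = r := Real.cos_arccos (by linarith) h1.le
  set s := Real.sin (Real.arccos r) with hs_def
  have hsr : s ^ 2 + r ^ 2 = 1 := by rw [← hc]; exact Real.sin_sq_add_cos_sq _
  set e : Fin n → ℝ := fun k => u k / A with he
  -- Gram-Schmidt for the pair (u/A, v/B): e and w are orthonormal and v/B = r e + s w, with r and s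
  -- the cosine and sine of arccos r.
  set w : Fin n → ℝ := fun k => (v k / B - r * (u k / A)) / s with hw
  have e1 : ∑ k, e k ^ 2 = 1 := by
    simp only [he, div_pow, ← Finset.sum_div, hu]
    exact div_self (by positivity)
  have e2 : ∑ k, e k * w k = 0 := by
    have : ∀ k, e k * w k = (u k * v k / (A * B) - r * (u k ^ 2 / A ^ 2)) / s := by
      intro k; simp only [he, hw]; field_simp
    simp only [this, ← Finset.sum_div, Finset.sum_sub_distrib, ← Finset.mul_sum, hu, huv]
    field_simp
    simp
  have e3 : ∑ k, w k ^ 2 = 1 := by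
    have : ∀ k, w k ^ 2 =
        (v k ^ 2 / B ^ 2 - 2 * r * (u k * v k / (A * B)) + r ^ 2 * (u k ^ 2 / A ^ 2)) / s ^ 2 := by
      intro k; simp only [hw]; field_simp; ring
    simp only [this, ← Finset.sum_div, Finset.sum_sub_distrib, Finset.sum_add_distrib,
      ← Finset.mul_sum, hu, huv, hv]
    field_simp
    linear_combination -hsr
  have hmap := map_linear_pi_eq e1 e3 e2
  rw [← gaussian_prod_sign_change hα0 hα1, ← hmap,
    Measure.map_apply (by fun_prop) (measurableSet_lt (by fun_prop) (by fun_prop))]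
  congr 1
  ext c
  simp only [Set.mem_ofPred_eq, Set.preimage_ofPred_eq, hc, ← hs_def]
  have f1 : ∑ k, c k * e k = (∑ k, c k * u k) / A := by
    rw [Finset.sum_div]; exact Finset.sum_congr rfl fun k _ => by simp only [he]; ring
  have f2 : r * ∑ k, c k * e k + s * ∑ k, c k * w k = (∑ k, c k * v k) / B := by
    rw [Finset.sum_div, Finset.mul_sum, Finset.mul_sum, ← Finset.sum_add_distrib]
    exact Finset.sum_congr rfl fun k _ => by simp only [he, hw]; field_simp; ring
  rw [f2, f1, div_mul_div_comm, div_neg_iff]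
  have : 0 < A * B := by positivity
  constructor
  · intro h; exact Or.inr ⟨h, this⟩
  · rintro (h | h)
    · linarith [h.2]
    · exact h.1

/-! ### Small-angle asymptotics of the correlation. -/

lemma tendsto_sub_sin_div_cube :
    Tendsto (fun x : ℝ => (x - Real.sin x) / x ^ 3) (𝓝[>] 0) (𝓝 (1 / 6)) := by
  have h : ∀ᶠ x : ℝ in 𝓝[>] 0, ‖(x - Real.sin x) / x ^ 3 - 1 / 6‖ ≤ x := by
    filter_upwards [Ioc_mem_nhdsGT (zero_lt_one : (0 : ℝ) < 1)] with x hx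
    have hx0 : 0 < x := hx.1
    have := Real.sin_bound (x := x) (by rw [abs_of_pos hx0]; exact hx.2)
    rw [abs_of_pos hx0] at this
    have e : (x - Real.sin x) / x ^ 3 - 1 / 6 = -((Real.sin x - (x - x ^ 3 / 6)) / x ^ 3) := by
      field_simp; ring
    rw [e, norm_neg, norm_div, Real.norm_eq_abs, Real.norm_eq_abs, abs_of_pos (pow_pos hx0 3),
      div_le_iff₀ (pow_pos hx0 3)]
    refine this.trans ?_
    have : 0 < x ^ 4 := by positivity
    have : x ^ 5 ≤ x ^ 4 := pow_le_pow_of_le_one hx0.le hx.2 (by norm_num)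
    have : x * x ^ 3 = x ^ 4 := by ring
    linarith
  rw [tendsto_iff_norm_sub_tendsto_zero]
  exact squeeze_zero' (Eventually.of_forall fun _ => norm_nonneg _) h
    (tendsto_id.mono_left nhdsWithin_le_nhds)

lemma tendsto_sin_div_self :
    Tendsto (fun x : ℝ => Real.sin x / x) (𝓝[>] 0) (𝓝 1) := by
  have h := (Real.hasDerivAt_sin 0).tendsto_slope_zero_right
  simp only [zero_add, Real.sin_zero, sub_zero, Real.cos_zero, smul_eq_mul] at h
  exact h.congr fun x => by rw [div_eq_inv_mul]

lemma tendsto_const_mul_nhdsGT_zero {c : ℝ} (hc : 0 < c) :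
    Tendsto (fun x : ℝ => c * x) (𝓝[>] 0) (𝓝[>] 0) := by
  refine tendsto_nhdsWithin_iff.2 ⟨?_, ?_⟩
  · have : Tendsto (fun x : ℝ => c * x) (𝓝 0) (𝓝 (c * 0)) := (continuous_const.mul continuous_id).tendsto 0
    rw [mul_zero] at this
    exact this.mono_left nhdsWithin_le_nhds
  · filter_upwards [self_mem_nhdsWithin] with x hx
    exact mul_pos hc hx

/-- Write n sin δ - sin nδ = (nδ - sin nδ) - n(δ - sin δ) and divide by nδ³ and by sin δ / δ. The
two cubic terms contribute n²/6 and 1/6. -/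
lemma tendsto_one_sub_dirichlet {n : ℕ} (hn : n ≠ 0) :
    Tendsto (fun δ : ℝ => (1 - Real.sin (n * δ) / (n * Real.sin δ)) / δ ^ 2) (𝓝[>] 0)
      (𝓝 (((n : ℝ) ^ 2 - 1) / 6)) := by
  have hn' : (0 : ℝ) < n := by positivity
  have h1 := tendsto_sub_sin_div_cube
  have h2 := h1.comp (tendsto_const_mul_nhdsGT_zero hn')
  have h3 := tendsto_sin_div_self
  have h := ((h2.mul_const ((n : ℝ) ^ 2)).sub h1).div h3 one_ne_zero
  have e : ((1 / 6 * (n : ℝ) ^ 2 - 1 / 6) / 1) = ((n : ℝ) ^ 2 - 1) / 6 := by ring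
  rw [e] at h
  refine h.congr' ?_
  filter_upwards [Ioo_mem_nhdsGT Real.pi_pos] with x hx
  have hs := (Real.sin_pos_of_mem_Ioo hx).ne'
  have hx0 := hx.1.ne'
  simp only [Function.comp, Pi.div_apply]
  field_simp
  ring

lemma tendsto_arccos_dirichlet {n : ℕ} (hn : 2 ≤ n) :
    Tendsto (fun δ : ℝ => Real.arccos (Real.sin (n * δ) / (n * Real.sin δ)) / δ) (𝓝[>] 0)
      (𝓝 √(((n : ℝ) ^ 2 - 1) / 3)) := by
  have hn' : (2 : ℝ) ≤ n := by exact_mod_cast hn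
  have hκ : 0 < ((n : ℝ) ^ 2 - 1) / 6 := by
    have : (1 : ℝ) < (n : ℝ) ^ 2 := by nlinarith
    linarith
  set r : ℝ → ℝ := fun δ => Real.sin (n * δ) / (n * Real.sin δ) with hr
  have h1 : Tendsto (fun δ => (1 - r δ) / δ ^ 2) (𝓝[>] 0) (𝓝 (((n : ℝ) ^ 2 - 1) / 6)) :=
    tendsto_one_sub_dirichlet (by omega)
  have hid : Tendsto (fun δ : ℝ => δ) (𝓝[>] 0) (𝓝 0) := tendsto_id.mono_left nhdsWithin_le_nhds
  have h2 : Tendsto (fun δ => 1 - r δ) (𝓝[>] 0) (𝓝 0) := by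
    have := h1.mul (hid.pow 2)
    rw [zero_pow two_ne_zero, mul_zero] at this
    refine this.congr' ?_
    filter_upwards [self_mem_nhdsWithin] with x hx
    have : x ≠ 0 := ne_of_gt hx
    field_simp
  have hpos : ∀ᶠ δ in 𝓝[>] 0, 0 < 1 - r δ := by
    filter_upwards [h1.eventually (lt_mem_nhds hκ), self_mem_nhdsWithin] with x hx hx0
    have : 0 < x ^ 2 := pow_pos hx0 2
    rcases div_pos_iff.1 hx with h | h
    · exact h.1
    · linarith [h.2]
  have hlt : ∀ᶠ δ in 𝓝[>] 0, 1 - r δ < 1 := h2.eventually (gt_mem_nhds one_pos)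
  have h3 : Tendsto (fun δ => √((1 - r δ) / 2)) (𝓝[>] 0) (𝓝[>] 0) := by
    refine tendsto_nhdsWithin_iff.2 ⟨?_, ?_⟩
    · have := (h2.div_const 2).sqrt
      simpa using this
    · filter_upwards [hpos] with x hx
      exact Real.sqrt_pos.2 (by linarith)
  have h4 : Tendsto (fun u : ℝ => Real.arcsin u / u) (𝓝[>] 0) (𝓝 1) := by
    have h := (Real.hasDerivAt_arcsin (x := 0) (by norm_num) (by norm_num)).tendsto_slope_zero_right
    simp only [zero_add, Real.arcsin_zero, sub_zero, smul_eq_mul] at h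
    simp only [ne_eq, OfNat.ofNat_ne_zero, not_false_eq_true, zero_pow, sub_zero, Real.sqrt_one,
      div_one] at h
    exact h.congr fun x => by rw [div_eq_inv_mul]
  have h5 := (h4.comp h3).mul ((h1.div_const 2).sqrt.const_mul 2)
  have e : 1 * (2 * √(((n : ℝ) ^ 2 - 1) / 6 / 2)) = √(((n : ℝ) ^ 2 - 1) / 3) := by
    rw [one_mul, show (2 : ℝ) = √4 by rw [show (4 : ℝ) = 2 ^ 2 by norm_num]; simp,
      ← Real.sqrt_mul (by norm_num)]
    rw [show √(4:ℝ) = 2 by rw [show (4 : ℝ) = 2 ^ 2 by norm_num]; simp]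
    congr 1
    ring
  rw [e] at h5
  refine h5.congr' ?_
  filter_upwards [hpos, hlt, self_mem_nhdsWithin] with x hx hx1 hx0
  have hx0 : 0 < x := hx0
  have hq : 0 < √((1 - r x) / 2) := Real.sqrt_pos.2 (by linarith)
  -- The half-angle identity moves the square-root singularity of arccos at 1 into an explicit
  -- square root, leaving arcsin, which is differentiable at 0.
  have hacc : Real.arccos (r x) = 2 * Real.arcsin √((1 - r x) / 2) := by
    set β := Real.arcsin √((1 - r x) / 2) with hβ
    have hle : √((1 - r x) / 2) ≤ 1 := by
      rw [Real.sqrt_le_one]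
      linarith
    have hsb : Real.sin β = √((1 - r x) / 2) := Real.sin_arcsin (by linarith) hle
    have hb0 : 0 ≤ β := Real.arcsin_nonneg.2 hq.le
    have hb1 : β ≤ Real.pi / 2 := Real.arcsin_le_pi_div_two _
    rw [← Real.arccos_cos (x := 2 * β) (by linarith) (by linarith)]
    congr 1
    rw [Real.cos_two_mul, Real.cos_sq', hsb, Real.sq_sqrt (by linarith)]
    ring
  simp only [Function.comp]
  rw [hacc, div_right_comm, Real.sqrt_div (by linarith : 0 ≤ (1 - r x) / 2) , Real.sqrt_sq hx0.le]
  field_simp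

/-! ### Sign changes on a grid against zeros of a polynomial. -/

/-- The indices of the cells of the grid `x 0, …, x M` in which `q` changes sign. -/
noncomputable def signChangeCells (q : ℝ[X]) (x : ℕ → ℝ) (M : ℕ) : Finset ℕ := by
  classical exact (Finset.range M).filter fun i => q.eval (x i) * q.eval (x (i + 1)) < 0

lemma mem_signChangeCells {q : ℝ[X]} {x : ℕ → ℝ} {M i : ℕ} :
    i ∈ signChangeCells q x M ↔ i < M ∧ q.eval (x i) * q.eval (x (i + 1)) < 0 := by
  classical
  simp [signChangeCells]

lemma Polynomial.exists_root_Ioo_of_mul_neg {q : ℝ[X]} {u v : ℝ} (huv : u < v)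
    (h : q.eval u * q.eval v < 0) : ∃ z ∈ Set.Ioo u v, q.eval z = 0 := by
  have hc : ContinuousOn (fun x => q.eval x) (Set.Icc u v) := q.continuous.continuousOn
  rcases mul_neg_iff.1 h with ⟨h1, h2⟩ | ⟨h1, h2⟩
  · exact intermediate_value_Ioo' huv.le hc ⟨h2, h1⟩
  · exact intermediate_value_Ioo huv.le hc ⟨h1, h2⟩

/-- Write q = (X - z) g. Then g has no zero on [u, v], so it keeps its sign, and only X - z changes
sign. -/
lemma Polynomial.mul_neg_of_unique_simple_root {q : ℝ[X]} {u v z : ℝ} (hz : z ∈ Set.Ioo u v)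
    (hq : q.eval z = 0) (hq' : q.derivative.eval z ≠ 0)
    (huniq : ∀ y ∈ Set.Icc u v, q.eval y = 0 → y = z) :
    q.eval u * q.eval v < 0 := by
  obtain ⟨g, rfl⟩ := dvd_iff_isRoot.2 hq
  have hgz : g.eval z ≠ 0 := by simpa [derivative_mul] using hq'
  have hg : ∀ y ∈ Set.Icc u v, g.eval y ≠ 0 := by
    intro y hy h0
    have := huniq y hy (by simp [h0])
    exact hgz (this ▸ h0)
  have huv : u < v := hz.1.trans hz.2
  have hpos : 0 < g.eval u * g.eval v := by
    by_contra! hle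
    rcases hle.lt_or_eq with hlt | heq
    · obtain ⟨y, hy, h0⟩ := exists_root_Ioo_of_mul_neg huv hlt
      exact hg y (Set.Ioo_subset_Icc_self hy) h0
    · rcases mul_eq_zero.1 heq with h0 | h0
      · exact hg u (Set.left_mem_Icc.2 huv.le) h0
      · exact hg v (Set.right_mem_Icc.2 huv.le) h0
  simp only [eval_mul, eval_sub, eval_X, eval_C]
  have h1 : (u - z) * (v - z) < 0 := mul_neg_of_neg_of_pos (by linarith [hz.1]) (by linarith [hz.2])
  calc _ = ((u - z) * (v - z)) * (g.eval u * g.eval v) := by ring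
    _ < 0 := mul_neg_of_neg_of_pos h1 hpos

/-- Each sign change yields a zero in its own open cell, and the cells are disjoint. No genericity
is needed, so this also provides the dominating bound later. -/
lemma card_signChangeCells_le {q : ℝ[X]} {x : ℕ → ℝ} {M : ℕ}
    (hx : ∀ i j, i < j → j ≤ M → x i < x j) :
    ((signChangeCells q x M).card : ℕ∞) ≤ ({z | q.eval z = 0} ∩ Set.Ioc (x 0) (x M)).encard := by
  have hex : ∀ i ∈ signChangeCells q x M, ∃ z ∈ Set.Ioo (x i) (x (i + 1)), q.eval z = 0 := by
    intro i hi
    obtain ⟨hiM, h⟩ := mem_signChangeCells.1 hi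
    exact exists_root_Ioo_of_mul_neg (hx i (i + 1) (by omega) (by omega)) h
  choose! z hz hz0 using hex
  have hmono : ∀ i j, i ≤ j → j ≤ M → x i ≤ x j := fun i j hij hj => by
    rcases hij.eq_or_lt with rfl | h
    · rfl
    · exact (hx i j h hj).le
  rw [← Set.encard_coe_eq_coe_finsetCard]
  refine Set.encard_le_encard_of_injOn (f := z) ?_ ?_
  · intro i hi
    have hiM := (mem_signChangeCells.1 hi).1
    exact ⟨hz0 i hi, (hmono 0 i (by omega) (by omega)).trans_lt (hz i hi).1,
      (hz i hi).2.le.trans (hmono (i + 1) M (by omega) le_rfl)⟩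
  · intro i hi j hj hij
    have hiM := (mem_signChangeCells.1 hi).1
    have hjM := (mem_signChangeCells.1 hj).1
    by_contra hne
    rcases lt_or_gt_of_ne hne with h | h
    · have := hmono (i + 1) j (by omega) (by omega)
      linarith [(hz i hi).2, (hz j hj).1]
    · have := hmono (j + 1) i (by omega) (by omega)
      linarith [(hz j hj).2, (hz i hi).1]

/-- The map from a zero to its cell is injective, and simplicity makes the cell one of sign change.
-/
lemma encard_le_card_signChangeCells {q : ℝ[X]} {x : ℕ → ℝ} {M : ℕ}
    (hsimple : ∀ z, q.eval z = 0 → q.derivative.eval z ≠ 0)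
    (hgrid : ∀ i ≤ M, q.eval (x i) ≠ 0)
    (huniq : ∀ i < M, ∀ y ∈ Set.Ioc (x i) (x (i + 1)), ∀ z ∈ Set.Ioc (x i) (x (i + 1)),
      q.eval y = 0 → q.eval z = 0 → y = z) :
    ({z | q.eval z = 0} ∩ Set.Ioc (x 0) (x M)).encard ≤ ((signChangeCells q x M).card : ℕ∞) := by
  have hcell : ∀ N ≤ M, ∀ z ∈ Set.Ioc (x 0) (x N), ∃ i < N, z ∈ Set.Ioc (x i) (x (i + 1)) := by
    intro N
    induction N with
    | zero => intro _ z hz; simp at hz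
    | succ N ih =>
      intro hN z hz
      rcases le_or_gt z (x N) with h | h
      · obtain ⟨i, hi, hzi⟩ := ih (by omega) z ⟨hz.1, h⟩
        exact ⟨i, by omega, hzi⟩
      · exact ⟨N, by omega, h, hz.2⟩
  have hex : ∀ z ∈ {z | q.eval z = 0} ∩ Set.Ioc (x 0) (x M),
      ∃ i < M, z ∈ Set.Ioc (x i) (x (i + 1)) := fun z hz => hcell M le_rfl z hz.2
  choose! f hf hfz using hex
  rw [← Set.encard_coe_eq_coe_finsetCard]
  refine Set.encard_le_encard_of_injOn (f := f) ?_ ?_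
  · intro z hz
    have hq0 : q.eval z = 0 := hz.1
    have hi := hf z hz
    have hzi := hfz z hz
    refine mem_signChangeCells.2 ⟨hi, ?_⟩
    refine mul_neg_of_unique_simple_root (z := z) ⟨hzi.1, lt_of_le_of_ne hzi.2 fun h => ?_⟩ hq0
      (hsimple z hq0) fun y hy hy0 => ?_
    · exact hgrid (f z + 1) (by omega) (h ▸ hq0)
    · refine huniq (f z) hi y ⟨lt_of_le_of_ne hy.1 fun h => ?_, hy.2⟩ z hzi hy0 hq0
      exact hgrid (f z) (by omega) (h ▸ hy0)
  · intro y hy z hz hyz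
    have h1 := hfz y hy
    rw [hyz] at h1
    exact huniq (f z) (hf z hz) y h1 z (hfz z hz) hy.1 hz.1

/-- The grid `a tan(s + i (t - s) / M)`. -/
noncomputable def tanGrid (a s t : ℝ) (M i : ℕ) : ℝ := a * Real.tan (s + i * ((t - s) / M))

lemma tanGrid_angle_mem {s t : ℝ} (hs : -(Real.pi / 2) < s) (hst : s < t) (ht : t < Real.pi / 2)
    {M i : ℕ} (hi : i ≤ M) :
    s + i * ((t - s) / M) ∈ Set.Ioo (-(Real.pi / 2)) (Real.pi / 2) := by
  rcases Nat.eq_zero_or_pos M with rfl | hM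
  · obtain rfl : i = 0 := by omega
    simp
    exact ⟨hs, hst.trans ht⟩
  · have hM' : (0 : ℝ) < M := by exact_mod_cast hM
    have h1 : 0 ≤ (i : ℝ) * ((t - s) / M) := by
      have : 0 < t - s := by linarith
      positivity
    have h2 : (i : ℝ) * ((t - s) / M) ≤ t - s := by
      rw [mul_div_assoc', div_le_iff₀ hM', mul_comm]
      have : (i : ℝ) ≤ M := by exact_mod_cast hi
      have : 0 < t - s := by linarith
      gcongr
    constructor <;> linarith

lemma tanGrid_strictMono {a : ℝ} (ha : 0 < a) {s t : ℝ} (hs : -(Real.pi / 2) < s) (hst : s < t)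
    (ht : t < Real.pi / 2) {M i j : ℕ} (hij : i < j) (hj : j ≤ M) :
    tanGrid a s t M i < tanGrid a s t M j := by
  have hM' : (0 : ℝ) < M := by exact_mod_cast (by omega : 0 < M)
  have : 0 < t - s := by linarith
  have hij' : (i : ℝ) < j := by exact_mod_cast hij
  refine mul_lt_mul_of_pos_left ?_ ha
  refine Real.tan_lt_tan_of_lt_of_lt_pi_div_two (tanGrid_angle_mem hs hst ht (by omega)).1
    (tanGrid_angle_mem hs hst ht hj).2 ?_
  gcongr

lemma tanGrid_zero (a s t : ℝ) (M : ℕ) : tanGrid a s t M 0 = a * Real.tan s := by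
  simp [tanGrid]

lemma tanGrid_last (a s t : ℝ) {M : ℕ} (hM : M ≠ 0) : tanGrid a s t M M = a * Real.tan t := by
  have : (M : ℝ) ≠ 0 := by exact_mod_cast hM
  rw [tanGrid]
  congr 2
  field_simp
  ring

lemma arctan_mem_of_mem_tanGrid_cell {a : ℝ} (ha : 0 < a) {s t : ℝ} (hs : -(Real.pi / 2) < s)
    (hst : s < t) (ht : t < Real.pi / 2) {M i : ℕ} (hi : i < M) {z : ℝ}
    (hz : z ∈ Set.Ioc (tanGrid a s t M i) (tanGrid a s t M (i + 1))) :
    Real.arctan (z / a) ∈ Set.Ioc (s + i * ((t - s) / M)) (s + i * ((t - s) / M) + (t - s) / M) := by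
  have m1 := tanGrid_angle_mem hs hst ht hi.le
  have m2 := tanGrid_angle_mem hs hst ht (show i + 1 ≤ M from hi)
  constructor
  · rw [← Real.arctan_tan m1.1 m1.2]
    refine Real.arctan_strictMono ?_
    rw [lt_div_iff₀ ha, mul_comm]
    exact hz.1
  · have e : s + i * ((t - s) / M) + (t - s) / M = s + (i + 1 : ℕ) * ((t - s) / M) := by
      push_cast; ring
    rw [e, ← Real.arctan_tan m2.1 m2.2]
    refine Real.arctan_strictMono.monotone ?_
    rw [div_le_iff₀ ha, mul_comm]
    exact hz.2

/-- For fine grids that avoid the zeros, the sign changes count the zeros. -/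
lemma eventually_card_signChangeCells_eq {a : ℝ} (ha : 0 < a) {s t : ℝ} (hs : -(Real.pi / 2) < s)
    (hst : s < t) (ht : t < Real.pi / 2) {q : ℝ[X]} (hq : q ≠ 0)
    (hsimple : ∀ z, q.eval z = 0 → q.derivative.eval z ≠ 0)
    (hgrid : ∀ M i, i ≤ M → q.eval (tanGrid a s t M i) ≠ 0) :
    ∀ᶠ M : ℕ in atTop, ((signChangeCells q (tanGrid a s t M) M).card : ℕ∞) =
      ({z | q.eval z = 0} ∩ Set.Ioc (a * Real.tan s) (a * Real.tan t)).encard := by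
  -- The angles of the zeros form a finite set, hence a separated one. Once the angular width (t -
  -- s) / M is below the separation, no cell holds two zeros.
  set A : Set ℝ := (fun z => Real.arctan (z / a)) '' {z | q.eval z = 0} with hA
  have hfin : A.Finite := by
    refine Set.Finite.image _ ?_
    refine (q.rootSet_finite ℝ).subset fun z hz => ?_
    rw [mem_rootSet]
    exact ⟨hq, by simpa using hz⟩
  have hsep : 0 < A.einfsep := hfin.einfsep_pos
  have hlim : Tendsto (fun M : ℕ => ENNReal.ofReal ((t - s) / M)) atTop (𝓝 0) := by
    have := ENNReal.tendsto_ofReal (tendsto_const_div_atTop_nhds_zero_nat (t - s))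
    simpa using this
  filter_upwards [hlim.eventually (gt_mem_nhds hsep), eventually_ne_atTop 0] with M hM hM0
  have hmono : ∀ i j, i < j → j ≤ M → tanGrid a s t M i < tanGrid a s t M j :=
    fun i j hij hj => tanGrid_strictMono ha hs hst ht hij hj
  rw [← tanGrid_zero a s t M, ← tanGrid_last a s t hM0]
  refine le_antisymm (card_signChangeCells_le hmono)
    (encard_le_card_signChangeCells hsimple (hgrid M) ?_)
  intro i hi y hy z hz hy0 hz0
  by_contra hne
  have hne' : Real.arctan (y / a) ≠ Real.arctan (z / a) := by
    intro h
    have := Real.arctan_injective h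
    rw [div_left_inj' ha.ne'] at this
    exact hne this
  have h1 := Set.einfsep_le_edist_of_mem (s := A) ⟨y, hy0, rfl⟩ ⟨z, hz0, rfl⟩ hne'
  have m1 := arctan_mem_of_mem_tanGrid_cell ha hs hst ht hi hy
  have m2 := arctan_mem_of_mem_tanGrid_cell ha hs hst ht hi hz
  have h2 : edist (Real.arctan (y / a)) (Real.arctan (z / a)) ≤ ENNReal.ofReal ((t - s) / M) := by
    rw [edist_dist]
    refine ENNReal.ofReal_le_ofReal ?_
    rw [Real.dist_eq, abs_le]
    constructor <;> linarith [m1.1, m1.2, m2.1, m2.2]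
  exact absurd hM (not_lt.2 (h1.trans h2))

/-! ### Almost sure simplicity of the zeros. -/

/-- Fubini in the coordinate of index 0, whose Gaussian law has no atoms. -/
lemma pi_gaussian_null_of_finite_fibers {m : ℕ} {D : Set (Fin (m + 1) → ℝ)}
    (hD : MeasurableSet D)
    (hfib : ∀ y : Fin m → ℝ, {c₀ : ℝ | (Fin.cons c₀ y : Fin (m + 1) → ℝ) ∈ D}.Finite) :
    Measure.pi (fun _ : Fin (m + 1) => gaussianReal 0 1) D = 0 := by
  have : NullSingletonClass (gaussianReal 0 1) := nullSingletonClass_gaussianReal one_ne_zero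
  have hmp := (measurePreserving_piFinSuccAbove (fun _ : Fin (m + 1) => gaussianReal 0 1) 0).symm
  rw [← hmp.measure_preimage_equiv, Measure.prod_apply_symm
    ((MeasurableEquiv.measurable _) hD), lintegral_eq_zero_iff' (by
      exact (measurable_measure_prodMk_right ((MeasurableEquiv.measurable _) hD)).aemeasurable)]
  refine Eventually.of_forall fun y => ?_
  refine Set.Finite.measure_zero ?_ _
  refine (hfib y).subset fun c hc => ?_
  have : (MeasurableEquiv.piFinSuccAbove (fun _ : Fin (m + 1) => ℝ) 0).symm (c, y) =
      Fin.cons c y := by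
    simp [MeasurableEquiv.piFinSuccAbove_symm_apply, Fin.insertNthEquiv]
  rw [Set.mem_ofPred_eq, ← this]
  exact hc

/-- The random polynomial with coefficients `c` in the family `p`. -/
noncomputable def randPoly {n : ℕ} (p : Fin n → ℝ[X]) (c : Fin n → ℝ) : ℝ[X] := ∑ k, C (c k) * p k

lemma eval_randPoly {n : ℕ} (p : Fin n → ℝ[X]) (c : Fin n → ℝ) (x : ℝ) :
    (randPoly p c).eval x = ∑ k, c k * (p k).eval x := by
  simp [randPoly, eval_finsetSum]

lemma eval_derivative_randPoly {n : ℕ} (p : Fin n → ℝ[X]) (c : Fin n → ℝ) (x : ℝ) :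
    (randPoly p c).derivative.eval x = ∑ k, c k * (p k).derivative.eval x := by
  simp [randPoly, eval_finsetSum, derivative_mul]

/-- For x confined to the compact interval [-M, M], the set is the projection of a closed set along
a compact factor, hence closed. -/
lemma measurableSet_exists_double_root {n : ℕ} (p : Fin n → ℝ[X]) :
    MeasurableSet {c : Fin n → ℝ | ∃ x, (randPoly p c).eval x = 0 ∧
      (randPoly p c).derivative.eval x = 0} := by
  have : {c : Fin n → ℝ | ∃ x, (randPoly p c).eval x = 0 ∧
      (randPoly p c).derivative.eval x = 0} = ⋃ M : ℕ, Prod.snd ''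
      {w : Set.Icc (-(M : ℝ)) M × (Fin n → ℝ) | (∑ k, w.2 k * (p k).eval (w.1 : ℝ)) = 0 ∧
        (∑ k, w.2 k * (p k).derivative.eval (w.1 : ℝ)) = 0} := by
    ext c
    simp only [Set.mem_ofPred_eq, Set.mem_iUnion, Set.mem_image, Prod.exists, exists_eq_right,
      eval_randPoly, eval_derivative_randPoly]
    constructor
    · rintro ⟨x, h⟩
      obtain ⟨M, hM⟩ := exists_nat_ge |x|
      exact ⟨M, ⟨x, abs_le.1 hM⟩, h⟩
    · rintro ⟨M, x, h⟩
      exact ⟨x, h⟩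
  rw [this]
  refine MeasurableSet.iUnion fun M => IsClosed.measurableSet ?_
  refine isClosedMap_snd_of_compactSpace _ ?_
  have hc : ∀ r : Fin n → ℝ[X], Continuous fun w : Set.Icc (-(M : ℝ)) M × (Fin n → ℝ) =>
      ∑ k, w.2 k * (r k).eval (w.1 : ℝ) := fun r => by
    refine continuous_finsetSum _ fun k _ => ?_
    exact ((continuous_apply k).comp continuous_snd).mul
      ((r k).continuous.comp (continuous_subtype_val.comp continuous_fst))
  exact (isClosed_eq (hc p) continuous_const).inter
    (isClosed_eq (hc fun k => (p k).derivative) continuous_const)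

lemma Polynomial.finite_criticalValues (g : ℝ[X]) :
    ((fun x => g.eval x) '' {x | g.derivative.eval x = 0}).Finite := by
  rcases eq_or_ne g.derivative 0 with h | h
  · obtain ⟨b, rfl⟩ : ∃ b, g = C b := ⟨_, eq_C_of_natDegree_eq_zero (derivative_eq_zero.1 h)⟩
    refine (Set.finite_singleton b).subset ?_
    rintro _ ⟨x, -, rfl⟩
    simp
  · refine Set.Finite.image _ ((g.derivative.rootSet_finite ℝ).subset fun z hz => ?_)
    rw [mem_rootSet]
    exact ⟨h, by simpa using hz⟩

/-- As `p 0` is a constant b, the polynomial is c₀ b + g with g independent of c₀. A double root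
forces -c₀ b to be a critical value of g, and those are finitely many. -/
lemma ae_simple_roots {m : ℕ} {p : Fin (m + 1) → ℝ[X]} {b : ℝ} (hb : b ≠ 0) (hp : p 0 = C b) :
    ∀ᵐ c ∂(Measure.pi (fun _ : Fin (m + 1) => gaussianReal 0 1)),
      ∀ z, (randPoly p c).eval z = 0 → (randPoly p c).derivative.eval z ≠ 0 := by
  have h := pi_gaussian_null_of_finite_fibers (measurableSet_exists_double_root p) fun y => by
    set g : ℝ[X] := ∑ k : Fin m, C (y k) * p k.succ with hg
    refine ((g.finite_criticalValues).image fun v => -v / b).subset ?_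
    rintro c₀ ⟨x, h1, h2⟩
    have e : randPoly p (Fin.cons c₀ y : Fin (m + 1) → ℝ) = C (c₀ * b) + g := by
      rw [randPoly, Fin.sum_univ_succ, hp, ← C_mul, hg]
      simp
    rw [e] at h1 h2
    refine ⟨g.eval x, ⟨x, ?_, rfl⟩, ?_⟩
    · simpa using h2
    · rw [eval_add, eval_C] at h1
      simp only
      rw [div_eq_iff hb]
      linarith
  rw [ae_iff]
  refine measure_mono_null (fun c hc => ?_) h
  simp only [Set.mem_ofPred_eq] at hc ⊢
  push Not at hc
  exact hc

lemma ae_eval_randPoly_ne_zero {m : ℕ} {p : Fin (m + 1) → ℝ[X]} {b : ℝ} (hb : b ≠ 0)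
    (hp : p 0 = C b) (x : ℝ) :
    ∀ᵐ c ∂(Measure.pi (fun _ : Fin (m + 1) => gaussianReal 0 1)), (randPoly p c).eval x ≠ 0 := by
  have hm : MeasurableSet {c : Fin (m + 1) → ℝ | (randPoly p c).eval x = 0} := by
    simp_rw [eval_randPoly]
    exact measurableSet_eq_fun (by fun_prop) (by fun_prop)
  have h := pi_gaussian_null_of_finite_fibers hm fun y => by
    refine (Set.finite_singleton (-(∑ k : Fin m, y k * (p k.succ).eval x) / b)).subset ?_
    intro c₀ h1
    simp only [Set.mem_ofPred_eq, eval_randPoly, Fin.sum_univ_succ, hp, Fin.cons_zero,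
      Fin.cons_succ, eval_C] at h1
    rw [Set.mem_singleton_iff, eq_div_iff hb]
    linarith
  rw [ae_iff]
  simpa using h

/-! ### Expected number of zeros in an interval. -/

lemma realZeros_eq {n : ℕ} (p : Fin n → ℝ[X]) (c : Fin n → ℝ) :
    realZeros p c = {x | (randPoly p c).eval x = 0} := by
  simp only [realZeros, eval_randPoly]

lemma measurableSet_sign_change {n : ℕ} (p : Fin n → ℝ[X]) (x y : ℝ) :
    MeasurableSet {c : Fin n → ℝ | (randPoly p c).eval x * (randPoly p c).eval y < 0} := by
  simp_rw [eval_randPoly]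
  exact measurableSet_lt (by fun_prop) (by fun_prop)

lemma card_signChangeCells_eq_sum {n : ℕ} (p : Fin n → ℝ[X]) (x : ℕ → ℝ) (M : ℕ)
    (c : Fin n → ℝ) :
    (((signChangeCells (randPoly p c) x M).card : ℕ) : ℝ≥0∞) = ∑ i ∈ Finset.range M,
      {c : Fin n → ℝ | (randPoly p c).eval (x i) * (randPoly p c).eval (x (i + 1)) < 0}.indicator
        (fun _ => (1 : ℝ≥0∞)) c := by
  classical
  rw [signChangeCells, Finset.card_filter]
  push_cast
  refine Finset.sum_congr rfl fun i _ => ?_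
  simp [Set.indicator]

lemma measurable_card_signChangeCells {n : ℕ} (p : Fin n → ℝ[X]) (x : ℕ → ℝ) (M : ℕ) :
    Measurable fun c : Fin n → ℝ =>
      (((signChangeCells (randPoly p c) x M).card : ℕ) : ℝ≥0∞) := by
  simp_rw [card_signChangeCells_eq_sum]
  exact Finset.measurable_sum _ fun i _ =>
    measurable_const.indicator (measurableSet_sign_change p _ _)

lemma lintegral_card_signChangeCells {n : ℕ} (p : Fin n → ℝ[X]) (x : ℕ → ℝ) (M : ℕ)
    (μ : Measure (Fin n → ℝ)) :
    ∫⁻ c, (((signChangeCells (randPoly p c) x M).card : ℕ) : ℝ≥0∞) ∂μ = ∑ i ∈ Finset.range M,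
      μ {c | (randPoly p c).eval (x i) * (randPoly p c).eval (x (i + 1)) < 0} := by
  simp_rw [card_signChangeCells_eq_sum]
  rw [lintegral_finsetSum _ fun i _ =>
    measurable_const.indicator (measurableSet_sign_change p _ _)]
  refine Finset.sum_congr rfl fun i _ => ?_
  rw [lintegral_indicator (measurableSet_sign_change p _ _)]
  simp

lemma encard_roots_le {q : ℝ[X]} (hq : q ≠ 0) {n : ℕ} (hn : q.natDegree ≤ n) (D : Set ℝ) :
    ({z | q.eval z = 0} ∩ D).encard ≤ (n : ℕ∞) := by
  classical
  have hsub : {z | q.eval z = 0} ∩ D ⊆ (q.roots.toFinset : Set ℝ) := fun z hz => by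
    simpa [hq] using hz.1
  refine (Set.encard_le_encard hsub).trans ?_
  rw [Set.encard_coe_eq_coe_finsetCard]
  exact_mod_cast (Multiset.toFinset_card_le _).trans ((card_roots' q).trans hn)

lemma natDegree_randPoly_le {n : ℕ} {p : Fin n → ℝ[X]} (hp : ∀ k, (p k).natDegree = k)
    (c : Fin n → ℝ) : (randPoly p c).natDegree ≤ n :=
  natDegree_sum_le_of_forall_le _ _ fun k _ =>
    (natDegree_C_mul_le _ _).trans ((hp k).le.trans k.2.le)

section

variable {a : ℝ} {n : ℕ} {p : Fin n → ℝ[X]}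

lemma IsOrthonormalPolynomials.prob_sign_change (ha : 0 < a) (hn : n ≠ 0)
    (hp : IsOrthonormalPolynomials (poissonPowMeasure a n) p) {s t : ℝ} (hs : 0 < Real.cos s)
    (ht : 0 < Real.cos t) (hst : Real.sin (t - s) ≠ 0)
    (h0 : 0 < Real.sin (n * (t - s)) / (n * Real.sin (t - s)))
    (h1 : Real.sin (n * (t - s)) / (n * Real.sin (t - s)) < 1) :
    Measure.pi (fun _ => gaussianReal 0 1) {c : Fin n → ℝ |
        (randPoly p c).eval (a * Real.tan s) * (randPoly p c).eval (a * Real.tan t) < 0} =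
      ENNReal.ofReal (Real.arccos (Real.sin (n * (t - s)) / (n * Real.sin (t - s))) / Real.pi) := by
  -- The points are swapped so that the correlation appears in t - s, the positive increment.
  simp_rw [eval_randPoly, mul_comm (∑ k, _ * (p k).eval (a * Real.tan s))]
  exact pi_gaussian_sign_change (kernelDiagSqrt_pos ha hn ht) (kernelDiagSqrt_pos ha hn hs)
    (hp.sum_sq_eval ha hn ht.ne') (hp.sum_sq_eval ha hn hs.ne')
    (hp.sum_mul_eval ha hn ht.ne' hs.ne' hst) h0 h1

lemma eventually_dirichlet_mem {n : ℕ} (hn : 2 ≤ n) :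
    ∀ᶠ δ : ℝ in 𝓝[>] 0, Real.sin δ ≠ 0 ∧ 0 < Real.sin (n * δ) / (n * Real.sin δ) ∧
      Real.sin (n * δ) / (n * Real.sin δ) < 1 := by
  have hn' : (2 : ℝ) ≤ n := by exact_mod_cast hn
  have h1 := tendsto_one_sub_dirichlet (n := n) (by omega)
  have hκ : 0 < ((n : ℝ) ^ 2 - 1) / 6 := by
    have : (1 : ℝ) < (n : ℝ) ^ 2 := by nlinarith
    linarith
  filter_upwards [h1.eventually (lt_mem_nhds hκ),
    Ioo_mem_nhdsGT (show (0 : ℝ) < Real.pi / n by positivity)] with δ hδ hδ'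
  have hδn : (n : ℝ) * δ < Real.pi := by
    have := (lt_div_iff₀ (by linarith)).1 hδ'.2
    linarith
  have hδ0 := hδ'.1
  have hδπ : δ < Real.pi := by nlinarith
  have hs := Real.sin_pos_of_pos_of_lt_pi hδ0 hδπ
  have hsn := Real.sin_pos_of_pos_of_lt_pi (show 0 < (n : ℝ) * δ by positivity) hδn
  refine ⟨hs.ne', by positivity, ?_⟩
  have : 0 < δ ^ 2 := by positivity
  have := (div_pos_iff_of_pos_right this).1 hδ
  linarith

/-- The correlation depends only on the angular step δ, so all M cells are equally likely to show a
sign change, and M = (t - s) / δ turns the sum into (t - s) times arccos(r(δ)) / (πδ). -/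
lemma IsOrthonormalPolynomials.tendsto_lintegral_card (ha : 0 < a) (hn : 2 ≤ n)
    (hp : IsOrthonormalPolynomials (poissonPowMeasure a n) p) {s t : ℝ}
    (hs : -(Real.pi / 2) < s) (hst : s < t) (ht : t < Real.pi / 2) :
    Tendsto (fun M : ℕ => ∫⁻ c, (((signChangeCells (randPoly p c) (tanGrid a s t M) M).card : ℕ) :
        ℝ≥0∞) ∂(Measure.pi (fun _ => gaussianReal 0 1))) atTop
      (𝓝 (ENNReal.ofReal (√(((n : ℝ) ^ 2 - 1) / 3) / Real.pi * (t - s)))) := by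
  have hδ : Tendsto (fun M : ℕ => (t - s) / (M : ℝ)) atTop (𝓝[>] 0) := by
    refine tendsto_nhdsWithin_iff.2 ⟨tendsto_const_div_atTop_nhds_zero_nat _, ?_⟩
    filter_upwards [eventually_gt_atTop 0] with M hM
    have : (0 : ℝ) < M := by exact_mod_cast hM
    exact div_pos (by linarith) this
  have hlim := (((tendsto_arccos_dirichlet hn).comp hδ).div_const Real.pi).mul_const (t - s)
  refine (ENNReal.tendsto_ofReal hlim).congr' ?_
  filter_upwards [hδ.eventually (eventually_dirichlet_mem hn), eventually_gt_atTop 0]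
    with M hM hM0
  have hM' : (0 : ℝ) < M := by exact_mod_cast hM0
  have hts : t - s ≠ 0 := by linarith
  rw [lintegral_card_signChangeCells]
  set δ := (t - s) / (M : ℝ) with hδ_def
  have hterm : ∀ i ∈ Finset.range M, Measure.pi (fun _ => gaussianReal 0 1) {c : Fin n → ℝ |
      (randPoly p c).eval (tanGrid a s t M i) * (randPoly p c).eval (tanGrid a s t M (i + 1)) < 0} =
      ENNReal.ofReal (Real.arccos (Real.sin (n * δ) / (n * Real.sin δ)) / Real.pi) := by
    intro i hi
    have hi := Finset.mem_range.1 hi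
    have m1 := tanGrid_angle_mem hs hst ht hi.le
    have m2 := tanGrid_angle_mem hs hst ht (show i + 1 ≤ M from hi)
    have e : s + (i + 1 : ℕ) * ((t - s) / M) - (s + i * ((t - s) / M)) = δ := by
      push_cast; ring
    have := hp.prob_sign_change ha (by omega) (Real.cos_pos_of_mem_Ioo m1)
      (Real.cos_pos_of_mem_Ioo m2) (by rw [e]; exact hM.1) (by rw [e]; exact hM.2.1)
      (by rw [e]; exact hM.2.2)
    rw [e] at this
    exact this
  rw [Finset.sum_congr rfl hterm, Finset.sum_const, Finset.card_range, nsmul_eq_mul,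
    ← ENNReal.ofReal_natCast, ← ENNReal.ofReal_mul hM'.le]
  congr 1
  simp only [Function.comp, ← hδ_def]
  have : t - s = M * δ := by rw [hδ_def]; field_simp
  have hδ0 : δ ≠ 0 := by
    intro h; rw [h, mul_zero] at this; exact hts this
  rw [this]
  field_simp

lemma IsOrthonormalPolynomials.ae_good (hn : n ≠ 0) {μ : Measure ℝ}
    (hp : IsOrthonormalPolynomials μ p) {ι : Type*} [Countable ι] (x : ι → ℝ) :
    ∀ᵐ c ∂(Measure.pi (fun _ : Fin n => gaussianReal 0 1)), randPoly p c ≠ 0 ∧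
      (∀ z, (randPoly p c).eval z = 0 → (randPoly p c).derivative.eval z ≠ 0) ∧
      ∀ i, (randPoly p c).eval (x i) ≠ 0 := by
  obtain ⟨m, rfl⟩ := Nat.exists_eq_succ_of_ne_zero hn
  have h0 := hp.1 0
  have hC : p 0 = C ((p 0).coeff 0) := eq_C_of_natDegree_eq_zero (by simpa using h0.1)
  have hb : (p 0).coeff 0 ≠ 0 := by
    intro h
    rw [h, C_0] at hC
    rw [hC] at h0
    simp at h0
  filter_upwards [ae_simple_roots hb hC, ae_eval_randPoly_ne_zero hb hC 0,
    ae_all_iff.2 fun i => ae_eval_randPoly_ne_zero hb hC (x i)] with c h1 h2 h3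
  exact ⟨fun h => h2 (by rw [h, eval_zero]), h1, h3⟩

lemma IsOrthonormalPolynomials.lintegral_encard_Ioc (ha : 0 < a) (hn : 2 ≤ n)
    (hp : IsOrthonormalPolynomials (poissonPowMeasure a n) p) {s t : ℝ}
    (hs : -(Real.pi / 2) < s) (hst : s < t) (ht : t < Real.pi / 2) :
    AEMeasurable (fun c => (((realZeros p c ∩ Set.Ioc (a * Real.tan s) (a * Real.tan t)).encard :
        ℕ∞) : ℝ≥0∞)) (Measure.pi (fun _ : Fin n => gaussianReal 0 1)) ∧
    ∫⁻ c, (((realZeros p c ∩ Set.Ioc (a * Real.tan s) (a * Real.tan t)).encard : ℕ∞) : ℝ≥0∞)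
      ∂(Measure.pi (fun _ : Fin n => gaussianReal 0 1)) =
      ENNReal.ofReal (√(((n : ℝ) ^ 2 - 1) / 3) / Real.pi * (t - s)) := by
  -- The index set collects the points of the grids of every size M: a countable family, avoided
  -- simultaneously.
  have hgood := hp.ae_good (by omega)
    (x := fun w : {w : ℕ × ℕ // w.2 ≤ w.1} => tanGrid a s t w.1.1 w.1.2)
  have hlim : ∀ᵐ c ∂(Measure.pi (fun _ : Fin n => gaussianReal 0 1)),
      Tendsto (fun M : ℕ => (((signChangeCells (randPoly p c) (tanGrid a s t M) M).card : ℕ) :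
        ℝ≥0∞)) atTop (𝓝 (((realZeros p c ∩ Set.Ioc (a * Real.tan s) (a * Real.tan t)).encard :
        ℕ∞) : ℝ≥0∞)) := by
    filter_upwards [hgood] with c ⟨h1, h2, h3⟩
    refine tendsto_const_nhds.congr' ?_
    filter_upwards [eventually_card_signChangeCells_eq ha hs hst ht h1 h2
      fun M i hi => h3 ⟨(M, i), hi⟩] with M hM
    rw [realZeros_eq, ← hM]
    simp
  have hmeas := fun M => (measurable_card_signChangeCells p (tanGrid a s t M) M).aemeasurable
    (μ := Measure.pi (fun _ : Fin n => gaussianReal 0 1))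
  refine ⟨aemeasurable_of_tendsto_metrizable_ae' hmeas hlim, ?_⟩
  refine tendsto_nhds_unique (tendsto_lintegral_of_dominated_convergence' (fun _ => (n : ℝ≥0∞))
    hmeas (fun M => ?_) (by simp) hlim) (hp.tendsto_lintegral_card ha hn hs hst ht)
  filter_upwards [hgood] with c ⟨h1, _, _⟩
  have h4 := (card_signChangeCells_le (q := randPoly p c) (x := tanGrid a s t M) (M := M)
    fun i j hij hj => tanGrid_strictMono ha hs hst ht hij hj).trans
    (encard_roots_le h1 (natDegree_randPoly_le (fun k => (hp.1 k).1) c) _)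
  exact_mod_cast h4

end

/-! ### The first intensity on Borel sets. -/

/-- The first intensity of the real zeros. -/
noncomputable def zeroIntensity (a : ℝ) (n : ℕ) (x : ℝ) : ℝ :=
  1 / Real.pi * √(((n : ℝ) ^ 2 - 1) / 3) * (a / (x ^ 2 + a ^ 2))

section

variable {a : ℝ} {n : ℕ} {p : Fin n → ℝ[X]}

lemma zeroIntensity_nonneg (ha : 0 < a) (n : ℕ) (x : ℝ) : 0 ≤ zeroIntensity a n x := by
  rw [zeroIntensity]; positivity

lemma measurable_zeroIntensity (a : ℝ) (n : ℕ) : Measurable (zeroIntensity a n) := by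
  unfold zeroIntensity; fun_prop

lemma zeroIntensity_eq (a : ℝ) (n : ℕ) (x : ℝ) : zeroIntensity a n x =
    √(((n : ℝ) ^ 2 - 1) / 3) / Real.pi * a * (x ^ 2 + a ^ 2)⁻¹ := by
  rw [zeroIntensity]; ring

lemma integrable_zeroIntensity (ha : 0 < a) (n : ℕ) : Integrable (zeroIntensity a n) := by
  have h := (integrable_inv_sq_add_sq ha).const_mul (√(((n : ℝ) ^ 2 - 1) / 3) / Real.pi * a)
  exact h.congr (Eventually.of_forall fun x => (zeroIntensity_eq a n x).symm)

lemma lintegral_zeroIntensity_Ioc (ha : 0 < a) (n : ℕ) {x y : ℝ} (hxy : x ≤ y) :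
    ∫⁻ z in Set.Ioc x y, ENNReal.ofReal (zeroIntensity a n z) =
      ENNReal.ofReal (√(((n : ℝ) ^ 2 - 1) / 3) / Real.pi *
        (Real.arctan (y / a) - Real.arctan (x / a))) := by
  rw [← ofReal_integral_eq_lintegral_ofReal (integrable_zeroIntensity ha n).integrableOn
    (Eventually.of_forall fun z => zeroIntensity_nonneg ha n z),
    ← intervalIntegral.integral_of_le hxy]
  simp_rw [zeroIntensity_eq, intervalIntegral.integral_const_mul, add_comm (_ ^ 2) (a ^ 2)]
  rw [integral_inv_sq_add_sq ha.ne']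
  congr 1
  field_simp

lemma lintegral_zeroIntensity (ha : 0 < a) (n : ℕ) :
    ∫⁻ z, ENNReal.ofReal (zeroIntensity a n z) = ENNReal.ofReal √(((n : ℝ) ^ 2 - 1) / 3) := by
  rw [← ofReal_integral_eq_lintegral_ofReal (integrable_zeroIntensity ha n)
    (Eventually.of_forall fun z => zeroIntensity_nonneg ha n z)]
  simp_rw [zeroIntensity_eq, integral_const_mul]
  rw [integral_inv_sq_add_sq_univ ha]
  congr 1
  field_simp

lemma measurableSet_realZeros (p : Fin n → ℝ[X]) (c : Fin n → ℝ) :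
    MeasurableSet (realZeros p c) := by
  rw [realZeros_eq]
  exact (isClosed_eq (randPoly p c).continuous continuous_const).measurableSet

/-- Both sides are countably additive: the left one because the number of zeros is a counting
measure, after exchanging sum and integral. -/
lemma expected_zeros_iUnion {μ : Measure (Fin n → ℝ)} {ι : Type*} [Countable ι] {f : ι → Set ℝ}
    (hd : Pairwise (Function.onFun Disjoint f)) (hf : ∀ i, MeasurableSet (f i))
    (h : ∀ i, AEMeasurable (fun c => (((realZeros p c ∩ f i).encard : ℕ∞) : ℝ≥0∞)) μ ∧
      ∫⁻ c, (((realZeros p c ∩ f i).encard : ℕ∞) : ℝ≥0∞) ∂μ =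
        ∫⁻ x in f i, ENNReal.ofReal (zeroIntensity a n x)) :
    AEMeasurable (fun c => (((realZeros p c ∩ ⋃ i, f i).encard : ℕ∞) : ℝ≥0∞)) μ ∧
      ∫⁻ c, (((realZeros p c ∩ ⋃ i, f i).encard : ℕ∞) : ℝ≥0∞) ∂μ =
        ∫⁻ x in ⋃ i, f i, ENNReal.ofReal (zeroIntensity a n x) := by
  have he : ∀ c, (((realZeros p c ∩ ⋃ i, f i).encard : ℕ∞) : ℝ≥0∞) =
      ∑' i, (((realZeros p c ∩ f i).encard : ℕ∞) : ℝ≥0∞) := by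
    intro c
    have hc : ∀ s : Set ℝ, MeasurableSet s → ((s.encard : ℕ∞) : ℝ≥0∞) = Measure.count s :=
      fun s hs => (Measure.count_apply hs).symm
    have hZ := measurableSet_realZeros p c
    rw [hc _ (hZ.inter (MeasurableSet.iUnion hf))]
    simp_rw [fun i => hc _ (hZ.inter (hf i))]
    rw [Set.inter_iUnion]
    exact measure_iUnion
      (fun i j hij => (hd hij).mono Set.inter_subset_right Set.inter_subset_right)
      fun i => hZ.inter (hf i)
  simp_rw [he]
  refine ⟨AEMeasurable.tsum fun i => (h i).1, ?_⟩
  rw [lintegral_tsum fun i => (h i).1, lintegral_iUnion hf hd]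
  exact tsum_congr fun i => (h i).2

/-- Induction over the π-system of half-open intervals. Complements need subtraction, which is
legitimate because the count is almost surely at most n and the intensity is integrable. -/
lemma IsOrthonormalPolynomials.expected_zeros (ha : 0 < a) (hn : 2 ≤ n)
    (hp : IsOrthonormalPolynomials (poissonPowMeasure a n) p) {D : Set ℝ} (hD : MeasurableSet D) :
    AEMeasurable (fun c => (((realZeros p c ∩ D).encard : ℕ∞) : ℝ≥0∞))
      (Measure.pi (fun _ : Fin n => gaussianReal 0 1)) ∧
    ∫⁻ c, (((realZeros p c ∩ D).encard : ℕ∞) : ℝ≥0∞)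
      ∂(Measure.pi (fun _ : Fin n => gaussianReal 0 1)) =
        ∫⁻ x in D, ENNReal.ofReal (zeroIntensity a n x) := by
  have hIoc : ∀ x y : ℝ, x < y →
      AEMeasurable (fun c => (((realZeros p c ∩ Set.Ioc x y).encard : ℕ∞) : ℝ≥0∞))
        (Measure.pi (fun _ : Fin n => gaussianReal 0 1)) ∧
      ∫⁻ c, (((realZeros p c ∩ Set.Ioc x y).encard : ℕ∞) : ℝ≥0∞)
        ∂(Measure.pi (fun _ : Fin n => gaussianReal 0 1)) =
          ∫⁻ x in Set.Ioc x y, ENNReal.ofReal (zeroIntensity a n x) := by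
    intro x y hxy
    have hlt : Real.arctan (x / a) < Real.arctan (y / a) :=
      Real.arctan_strictMono (by gcongr)
    have h := hp.lintegral_encard_Ioc ha hn (Real.neg_pi_div_two_lt_arctan _) hlt
      (Real.arctan_lt_pi_div_two _)
    rw [Real.tan_arctan, Real.tan_arctan, mul_div_cancel₀ _ ha.ne', mul_div_cancel₀ _ ha.ne'] at h
    rwa [lintegral_zeroIntensity_Ioc ha n hxy.le]
  have huniv : AEMeasurable (fun c => (((realZeros p c ∩ Set.univ).encard : ℕ∞) : ℝ≥0∞))
        (Measure.pi (fun _ : Fin n => gaussianReal 0 1)) ∧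
      ∫⁻ c, (((realZeros p c ∩ Set.univ).encard : ℕ∞) : ℝ≥0∞)
        ∂(Measure.pi (fun _ : Fin n => gaussianReal 0 1)) =
          ∫⁻ x in Set.univ, ENNReal.ofReal (zeroIntensity a n x) := by
    -- The whole line is treated beforehand, as a disjoint union of unit intervals, because
    -- complements are taken relative to it.
    rw [← iUnion_Ioc_intCast ℝ]
    exact expected_zeros_iUnion (Set.pairwise_disjoint_Ioc_intCast ℝ)
      (fun i => measurableSet_Ioc) fun i => hIoc _ _ (by linarith)
  induction D, hD using MeasurableSpace.induction_on_inter (borel_eq_generateFrom_Ioc ℝ ▸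
    BorelSpace.measurable_eq (α := ℝ)) (isPiSystem_Ioc (id : ℝ → ℝ) id) with
  | empty => simp
  | basic t ht =>
    obtain ⟨l, u, hlu, rfl⟩ := ht
    exact hIoc l u hlu
  | compl t htm ih =>
    have hsplit : ∀ c, (((realZeros p c ∩ Set.univ).encard : ℕ∞) : ℝ≥0∞) =
        (((realZeros p c ∩ t).encard : ℕ∞) : ℝ≥0∞) +
          (((realZeros p c ∩ tᶜ).encard : ℕ∞) : ℝ≥0∞) := by
      intro c
      rw [← ENat.toENNReal_add, ← Set.encard_union_eq, ← Set.inter_union_distrib_left,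
        Set.union_compl_self]
      exact (disjoint_compl_right).mono Set.inter_subset_right Set.inter_subset_right
    have hfin : ∀ᵐ c ∂(Measure.pi (fun _ : Fin n => gaussianReal 0 1)),
        (((realZeros p c ∩ t).encard : ℕ∞) : ℝ≥0∞) ≠ ⊤ := by
      filter_upwards [hp.ae_good (by omega) (x := fun i : Empty => i.elim)] with c hc
      have h4 := encard_roots_le hc.1 (natDegree_randPoly_le (fun k => (hp.1 k).1) c) t
      rw [← realZeros_eq] at h4
      refine ne_of_lt (lt_of_le_of_lt (b := (n : ℝ≥0∞)) ?_ (ENNReal.natCast_lt_top n))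
      exact_mod_cast h4
    have hmeas : AEMeasurable (fun c => (((realZeros p c ∩ tᶜ).encard : ℕ∞) : ℝ≥0∞))
        (Measure.pi (fun _ : Fin n => gaussianReal 0 1)) := by
      refine (huniv.1.sub ih.1).congr ?_
      filter_upwards [hfin] with c hc
      rw [Pi.sub_apply, hsplit c, ENNReal.add_sub_cancel_left hc]
    refine ⟨hmeas, ?_⟩
    have h1 := huniv.2
    simp_rw [hsplit] at h1
    rw [lintegral_add_left' ih.1, ih.2, Measure.restrict_univ,
      ← lintegral_add_compl (μ := volume) (fun x => ENNReal.ofReal (zeroIntensity a n x)) htm] at h1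
    refine (ENNReal.add_right_inj (ne_of_lt ?_)).1 h1
    exact (integrable_zeroIntensity ha n).integrableOn.lintegral_lt_top
  | iUnion f hd hf ih => exact expected_zeros_iUnion hd hf ih

end

theorem mainTheorem9 (a : ℝ) (ha : 0 < a) (n : ℕ) (hn : 2 ≤ n)
    (E : ℂ → ℂ) (hE : ∀ z : ℂ, E z = (z + Complex.I * (a : ℂ)) ^ n) :
    (IsHermiteBiehler E ∧ ∀ x : ℝ, E (x : ℂ) ≠ 0) ∧
    (∃ φ : ℝ → ℝ, (∀ x : ℝ, HasDerivAt φ (a / (x ^ 2 + a ^ 2)) x) ∧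
      IsPhaseFunction E (fun x => (n : ℝ) * φ x)) ∧
    (∃ p : Fin n → ℝ[X], IsOrthonormalPolynomials (poissonPowMeasure a n) p) ∧
    ∀ p : Fin n → ℝ[X], IsOrthonormalPolynomials (poissonPowMeasure a n) p →
      IsDeBrangesOrthonormalBasis E (fun k z => aeval z (p k)) ∧
      ∀ (Ω : Type*) [MeasurableSpace Ω] (P : Measure Ω) [IsProbabilityMeasure P]
        (ξ : Fin n → Ω → ℝ),
        (∀ k, HasLaw (ξ k) (gaussianReal 0 1) P) → iIndepFun ξ P →
        HasFirstIntensity P (fun w => realZeros p (fun k => ξ k w))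
          (fun x => 1 / Real.pi * √(((n : ℝ) ^ 2 - 1) / 3) * (a / (x ^ 2 + a ^ 2))) ∧
        ∫⁻ w, (((realZeros p (fun k => ξ k w)).encard : ℕ∞) : ℝ≥0∞) ∂P =
          ENNReal.ofReal √(((n : ℝ) ^ 2 - 1) / 3) := by
  have hn0 : n ≠ 0 := by omega
  obtain rfl : E = fun z => (z + Complex.I * (a : ℂ)) ^ n := funext hE
  refine ⟨⟨isHermiteBiehler_pow ha hn0, fun x => pow_ne_zero _ (real_add_I_mul_ne_zero ha.ne' x).1⟩,
    exists_phase_pow ha hn0, exists_isOrthonormalPolynomials ha hn0, fun p hp =>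
    ⟨hp.isDeBrangesOrthonormalBasis ha hn0, ?_⟩⟩
  intro Ω _ P _ ξ hξ hind
  have hm : AEMeasurable (fun w k => ξ k w) P := aemeasurable_pi_lambda _ fun k => (hξ k).aemeasurable
  -- Independence identifies the law of the coefficient vector with the product Gaussian, so
  -- everything can be computed on `Fin n → ℝ`.
  have hlaw : P.map (fun w k => ξ k w) = Measure.pi (fun _ : Fin n => gaussianReal 0 1) := by
    rw [(iIndepFun_iff_map_fun_eq_pi_map fun k => (hξ k).aemeasurable).1 hind]
    congr 1
    ext1 k
    exact (hξ k).map_eq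
  have key : ∀ D : Set ℝ, MeasurableSet D →
      AEMeasurable (fun w => (((realZeros p (fun k => ξ k w) ∩ D).encard : ℕ∞) : ℝ≥0∞)) P ∧
      ∫⁻ w, (((realZeros p (fun k => ξ k w) ∩ D).encard : ℕ∞) : ℝ≥0∞) ∂P =
        ∫⁻ x in D, ENNReal.ofReal (zeroIntensity a n x) := by
    intro D hD
    obtain ⟨h1, h2⟩ := hp.expected_zeros ha hn hD
    rw [← hlaw] at h1 h2
    exact ⟨h1.comp_aemeasurable hm, by rw [← h2, lintegral_map' h1 hm]⟩
  refine ⟨⟨measurable_zeroIntensity a n, zeroIntensity_nonneg ha n, key⟩, ?_⟩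
  have h := (key Set.univ MeasurableSet.univ).2
  simp only [Set.inter_univ, Measure.restrict_univ] at h
  rw [h, lintegral_zeroIntensity ha]
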